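/- **Theorem (Lindström).** Everything is many-sorted. A vocabulary is a nonempty set of sort symbols, finitary relation symbols and finitary function symbols (constants are function symbols of arity $0$), each relation or function symbol having fixed argument sorts (and value sort) that belong to the vocabulary; symbols are named by elements of a fixed infinite set, so that infinitely many symbols of each type are available. A structure $\mathcal M$ has a vocabulary $\tau(\mathcal M)$, a nonempty domain for each sort in $\tau(\mathcal M)$, and interpretations of the other symbols in $\tau(\mathcal M)$. An *abstract logic* $L=(S,F,\models,\tau)$ consists of the class $S$ of all such structures, a class $F$ of sentences, a relation $\models\ \subseteq S\times F$, and a vocabulary $\tau(\varphi)$ for each $\varphi\in F$, such that $\mathcal M\models\varphi$ implies $\tau(\varphi)\subseteq\tau(\mathcal M)$. For $T\subseteq F$ put $\tau(T)=\bigcup_{\varphi\in T}\tau(\varphi)$. A class $T\subseteq F$ is *consistent* if it has a model, and *complete* if $T=\{\varphi\in F:\mathcal M\models\varphi\}$ for some $\mathcal M\in S$. $L$ is *regular* if it has the following properties. 1. (Isomorphism) If $\mathcal M\cong\mathcal N$ and $\mathcal M\models\varphi$ then $\mathcal N\models\varphi$. 2. (Reduct) If $\tau(\varphi)\subseteq\tau(\mathcal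 M)$, then $\mathcal M\models\varphi$ iff $\mathcal M\restriction\tau(\varphi)\models\varphi$. 3. (Renaming) If $\rho:\tau\to\sigma$ is a bijection of vocabularies respecting kinds and sorts of symbols and $\tau(\varphi)\subseteq\tau$, there is $\varphi'\in F$ with $\tau(\varphi')\subseteq\sigma$ such that $\mathcal M\models\varphi$ iff $\mathcal M^\rho\models\varphi'$ for all $\tau$-structures $\mathcal M$. 4. (Atoms) Every atomic first-order sentence (an equation between closed terms or a relation symbol applied to closed terms) is equivalent to a sentence of $L$ with the same vocabulary. 5. (Negation, conjunction) For $\varphi,\psi\in F$ there are $\neg\varphi,\varphi\wedge\psi\in F$ with $\tau(\neg\varphi)=\tau(\varphi)$, $\tau(\varphi\wedge\psi)=\tau(\varphi)\cup\tau(\psi)$, and the usual meaning in every structure whose vocabulary contains $\tau(\neg\varphi)$, respectively $\tau(\varphi\wedge\psi)$. 6. (Particularization) If $c\in\tau(\varphi)$ is a constant of sort $s$, there is $\theta\in F$ with $\tau(\theta)=\tau(\varphi)\setminus\{c\}$ such that a structure $\mathcal M$ of this vocabulary satisfies $\theta$ iff $(\mathcal M,a)\models\varphi$ for some $a\in M_s$,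 where $(\mathcal M,a)$ interprets $c$ by $a$. 7. (Relativization) For $\varphi,\chi\in F$, a sort $s\in\tau(\varphi)$ and a constant $c$ of sort $s$ there is $\theta\in F$ with $\tau(\theta)\subseteq\tau(\varphi)\cup(\tau(\chi)\setminus\{c\})$ such that for all $\mathcal M$ with $\tau(\varphi)\cup(\tau(\chi)\setminus\{c\})\subseteq\tau(\mathcal M)$ and $c\notin\tau(\mathcal M)$: if restricting the domain of sort $s$ to $X=\{a\in M_s:(\mathcal M,a)\models\chi\}$ gives a substructure of $\mathcal M\restriction\tau(\varphi)$, then $\mathcal M\models\theta$ iff this substructure satisfies $\varphi$. 8. (Substitution) For $\varphi,\chi\in F$, a relation symbol $R\in\tau(\varphi)$ with argument sorts $s_1,\dots,s_n$, and distinct constants $c_i$ of sort $s_i$, there is $\theta\in F$ with $\tau(\theta)\subseteq\sigma:=(\tau(\varphi)\setminus\{R\})\cup(\tau(\chi)\setminus\{c_1,\dots,c_n\})$ such that for all $\mathcal M$ with $\tau(\mathcal M)\supseteq\sigma\cup\{s_1,\dots,s_n\}$ and $R,c_1,\dots,c_n\notin\tau(\mathcal M)$: $\mathcal M\models\theta$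 iff $(\mathcal M,X)\models\varphi$, where $X=\{\vec a:(\mathcal M,\vec a)\models\chi\}$ interprets $R$. Let $L$ be a regular abstract logic such that - $L$ is compact: every set $T\subseteq F$ all of whose finite subsets are consistent is consistent; - $L$ has the Löwenheim property: every sentence with a model has a countable model; - $\tau(\varphi)$ is finite for every $\varphi\in F$. Then $L$ has the Robinson property: if $T_0$ is complete, $T_1,T_2\supseteq T_0$ are consistent and $\tau(T_1)\cap\tau(T_2)=\tau(T_0)$, then $T_1\cup T_2$ is consistent. Moreover $L$ is equivalent to many-sorted first-order logic with equality $L_{\omega\omega}$: for every sentence of either logic there is a sentence of the other one with the same models and the same vocabulary. -/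

import Mathlib

universe u w w'

namespace ManySorted

/-! ## Symbols and vocabularies -/

/-- Many-sorted symbols with names taken from `N`. A relation symbol carries the sorts of its
arguments, a function symbol the sorts of its arguments and of its value. -/
inductive Symbol (N : Type u) : Type u
  | sort (s : N) : Symbol N
  | rel (name : N) {n : ℕ} (dom : Fin n → N) : Symbol N
  | func (name : N) {n : ℕ} (dom : Fin n → N) (cod : N) : Symbol N

/-- The constant symbol of sort `s` with name `c`: constants are function symbols of arity `0`. -/
def Symbol.const {N : Type u} (c s : N) : Symbol N := Symbol.func c (Fin.elim0 : Fin 0 → N) s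

/-- A vocabulary is a nonempty set of symbols that contains with every symbol its sorts. -/
structure IsVocabulary {N : Type u} (σ : Set (Symbol N)) : Prop where
  nonempty : σ.Nonempty
  rel_dom : ∀ (R : N) {n : ℕ} (dom : Fin n → N), Symbol.rel R dom ∈ σ →
    ∀ i, Symbol.sort (dom i) ∈ σ
  func_dom : ∀ (f : N) {n : ℕ} (dom : Fin n → N) (cod : N), Symbol.func f dom cod ∈ σ →
    ∀ i, Symbol.sort (dom i) ∈ σ
  func_cod : ∀ (f : N) {n : ℕ} (dom : Fin n → N) (cod : N), Symbol.func f dom cod ∈ σ →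
    Symbol.sort cod ∈ σ

/-- The objects that may interpret a symbol, over a family of domains. -/
def Symbol.Value {N : Type u} (Dom : N → Type u) : Symbol N → Type u
  | .sort _ => PUnit
  | .rel _ dom => ((i : _) → Dom (dom i)) → Prop
  | .func _ dom cod => ((i : _) → Dom (dom i)) → Dom cod

/-! ## Structures -/

/-- A many-sorted structure with vocabulary `voc` and nonempty domains.
For convenience `Dom` and `interp` are total functions; only their values at the symbols of `voc`
belong to the structure. The values elsewhere are invisible to everything below:
isomorphisms ignore them, and logics are required to be closed under isomorphism. -/
structure Struct (N : Type u) : Type (u + 1) where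
  voc : Set (Symbol N)
  isVocabulary : IsVocabulary voc
  Dom : N → Type u
  nonempty : ∀ s, Nonempty (Dom s)
  interp : (S : Symbol N) → S.Value Dom

namespace Struct

variable {N : Type u}

/-- The interpretation of a relation symbol. -/
def rel (M : Struct N) (R : N) {n : ℕ} (dom : Fin n → N) (x : (i : Fin n) → M.Dom (dom i)) : Prop :=
  M.interp (.rel R dom) x

/-- The interpretation of a function symbol. -/
def func (M : Struct N) (f : N) {n : ℕ} (dom : Fin n → N) (cod : N)
    (x : (i : Fin n) → M.Dom (dom i)) : M.Dom cod :=
  M.interp (.func f dom cod) x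

/-- The reduct of `M` to a subvocabulary. -/
def reduct (M : Struct N) (σ : Set (Symbol N)) (hσ : IsVocabulary σ) (_ : σ ⊆ M.voc) :
    Struct N :=
  { M with voc := σ, isVocabulary := hσ }

/-- `M` is countable: its domains, taken together, form a countable set. -/
def IsCountable (M : Struct N) : Prop :=
  Countable (Σ s : {s : N // Symbol.sort s ∈ M.voc}, M.Dom s.1)

/-- The family of maps `e` respects (in both directions) the relations and functions of `σ`. -/
structure Respects (σ : Set (Symbol N)) (A B : Struct N) (e : ∀ s, A.Dom s → B.Dom s) : Prop where
  rel : ∀ (R : N) {n : ℕ} (dom : Fin n → N), Symbol.rel R dom ∈ σ →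
    ∀ x : (i : Fin n) → A.Dom (dom i), A.rel R dom x ↔ B.rel R dom (fun i => e _ (x i))
  func : ∀ (f : N) {n : ℕ} (dom : Fin n → N) (cod : N), Symbol.func f dom cod ∈ σ →
    ∀ x : (i : Fin n) → A.Dom (dom i),
      e cod (A.func f dom cod x) = B.func f dom cod (fun i => e _ (x i))

/-- Isomorphism: the vocabularies agree, and there is a family of bijections between the domains
of the sorts in the vocabulary that respects the relations and functions in the vocabulary. -/
def Iso (A B : Struct N) : Prop :=
  A.voc = B.voc ∧ ∃ e : ∀ s, A.Dom s → B.Dom s,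
    (∀ s, Symbol.sort s ∈ A.voc → Function.Bijective (e s)) ∧ Respects A.voc A B e

theorem isVocabulary_insert_const {σ : Set (Symbol N)} (h : IsVocabulary σ) {c s : N}
    (hs : Symbol.sort s ∈ σ) : IsVocabulary (insert (Symbol.const c s) σ) where
  nonempty := Set.insert_nonempty _ _
  rel_dom R n dom hR i := by
    rcases hR with hR | hR
    · cases hR
    · exact Or.inr (h.rel_dom R dom hR i)
  func_dom f n dom cod hf i := by
    rcases hf with hf | hf
    · simp only [Symbol.const, Symbol.func.injEq] at hf
      obtain ⟨_, rfl, _⟩ := hf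
      exact i.elim0
    · exact Or.inr (h.func_dom f dom cod hf i)
  func_cod f n dom cod hf := by
    rcases hf with hf | hf
    · simp only [Symbol.const, Symbol.func.injEq] at hf
      obtain ⟨_, _, _, rfl⟩ := hf
      exact Or.inr hs
    · exact Or.inr (h.func_cod f dom cod hf)

theorem isVocabulary_union_consts {σ : Set (Symbol N)} (h : IsVocabulary σ) {n : ℕ}
    {c s : Fin n → N} (hs : ∀ i, Symbol.sort (s i) ∈ σ) :
    IsVocabulary (σ ∪ Set.range fun i => Symbol.const (c i) (s i)) where
  nonempty := h.nonempty.mono Set.subset_union_left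
  rel_dom R m dom hR i := by
    rcases hR with hR | ⟨j, hR⟩
    · exact Or.inl (h.rel_dom R dom hR i)
    · cases hR
  func_dom f m dom cod hf i := by
    rcases hf with hf | ⟨j, hf⟩
    · exact Or.inl (h.func_dom f dom cod hf i)
    · simp only [Symbol.const, Symbol.func.injEq] at hf
      obtain ⟨_, rfl, _⟩ := hf
      exact i.elim0
  func_cod f m dom cod hf := by
    rcases hf with hf | ⟨j, hf⟩
    · exact Or.inl (h.func_cod f dom cod hf)
    · simp only [Symbol.const, Symbol.func.injEq] at hf
      obtain ⟨_, _, _, rfl⟩ := hf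
      exact Or.inl (hs j)

theorem isVocabulary_insert_rel {σ : Set (Symbol N)} (h : IsVocabulary σ) {R : N} {n : ℕ}
    {dom : Fin n → N} (hs : ∀ i, Symbol.sort (dom i) ∈ σ) :
    IsVocabulary (insert (Symbol.rel R dom) σ) where
  nonempty := Set.insert_nonempty _ _
  rel_dom R' m dom' hR i := by
    rcases hR with hR | hR
    · simp only [Symbol.rel.injEq] at hR
      obtain ⟨_, rfl, hd⟩ := hR
      cases hd
      exact Or.inr (hs i)
    · exact Or.inr (h.rel_dom R' dom' hR i)
  func_dom f m dom' cod hf i := by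
    rcases hf with hf | hf
    · cases hf
    · exact Or.inr (h.func_dom f dom' cod hf i)
  func_cod f m dom' cod hf := by
    rcases hf with hf | hf
    · cases hf
    · exact Or.inr (h.func_cod f dom' cod hf)

open Classical in
/-- `(M, a)`: the constant `c` of sort `s` is interpreted by the element `a`. -/
noncomputable def withConst (M : Struct N) (c s : N) (hs : Symbol.sort s ∈ M.voc) (a : M.Dom s) :
    Struct N where
  voc := insert (Symbol.const c s) M.voc
  isVocabulary := isVocabulary_insert_const M.isVocabulary hs
  Dom := M.Dom
  nonempty := M.nonempty
  interp := Function.update M.interp (Symbol.const c s)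
    (show (Symbol.const c s).Value M.Dom from fun _ => a)

open Classical in
/-- `(M, a₁, …, aₙ)`: the (distinct) constants `c i` of sort `s i` are interpreted by the
elements `a i`. -/
noncomputable def withConsts (M : Struct N) {n : ℕ} (c s : Fin n → N)
    (hs : ∀ i, Symbol.sort (s i) ∈ M.voc) (a : ∀ i, M.Dom (s i)) : Struct N where
  voc := M.voc ∪ Set.range fun i => Symbol.const (c i) (s i)
  isVocabulary := isVocabulary_union_consts M.isVocabulary hs
  Dom := M.Dom
  nonempty := M.nonempty
  interp := fun S =>
    if h : ∃ i, Symbol.const (c i) (s i) = S then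
      h.choose_spec ▸
        (show (Symbol.const (c h.choose) (s h.choose)).Value M.Dom from fun _ => a h.choose)
    else M.interp S

open Classical in
/-- `(M, X)`: the relation symbol `R` is interpreted by the relation `X`. -/
noncomputable def withRel (M : Struct N) (R : N) {n : ℕ} (dom : Fin n → N)
    (hs : ∀ i, Symbol.sort (dom i) ∈ M.voc) (X : Set ((i : Fin n) → M.Dom (dom i))) :
    Struct N where
  voc := insert (Symbol.rel R dom) M.voc
  isVocabulary := isVocabulary_insert_rel M.isVocabulary hs
  Dom := M.Dom
  nonempty := M.nonempty
  interp := Function.update M.interp (Symbol.rel R dom)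
    (show (Symbol.rel R dom).Value M.Dom from fun x => x ∈ X)

end Struct

/-! ## Renamings -/

/-- A translation of symbols: sorts go to sorts, relation symbols to relation symbols and function
symbols to function symbols, compatibly with the sorts of arguments and values. -/
structure Translation (N : Type u) where
  sort : N → N
  relName : N → {n : ℕ} → (Fin n → N) → N
  funcName : N → {n : ℕ} → (Fin n → N) → N → N

/-- The action of a translation on symbols. -/
def Translation.onSymbol {N : Type u} (ρ : Translation N) : Symbol N → Symbol N
  | .sort s => .sort (ρ.sort s)
  | .rel R dom => .rel (ρ.relName R dom) (fun i => ρ.sort (dom i))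
  | .func f dom cod => .func (ρ.funcName f dom cod) (fun i => ρ.sort (dom i)) (ρ.sort cod)

/-- `ρ` restricts to a renaming of the vocabulary `τ` to the vocabulary `σ`. -/
def Translation.IsRenaming {N : Type u} (ρ : Translation N) (τ σ : Set (Symbol N)) : Prop :=
  Set.BijOn ρ.onSymbol τ σ

/-- For a renaming `ρ` of `τ` to the vocabulary of `B`, the `τ`-structure that becomes `B` when its
symbols are renamed by `ρ`: it interprets a symbol of `τ` as `B` interprets the renamed symbol. -/
def Struct.unrename {N : Type u} (B : Struct N) (ρ : Translation N) (τ : Set (Symbol N))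
    (hτ : IsVocabulary τ) : Struct N where
  voc := τ
  isVocabulary := hτ
  Dom := fun s => B.Dom (ρ.sort s)
  nonempty := fun s => B.nonempty (ρ.sort s)
  interp
    | .sort _ => PUnit.unit
    | .rel R dom => B.rel (ρ.relName R dom) (fun i => ρ.sort (dom i))
    | .func f dom cod => B.func (ρ.funcName f dom cod) (fun i => ρ.sort (dom i)) (ρ.sort cod)

/-! ## First-order logic -/

/-- Many-sorted terms; `var s k` is the `k`-th variable of sort `s`. -/
inductive Term (N : Type u) : N → Type u
  | var (s : N) (k : ℕ) : Term N s
  | app (f : N) {n : ℕ} (dom : Fin n → N) (cod : N) (t : (i : Fin n) → Term N (dom i)) : Term N cod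

namespace Term

variable {N : Type u}

/-- The symbols of a term, including the sorts of its subterms. -/
def voc : {s : N} → Term N s → Set (Symbol N)
  | _, .var s _ => {Symbol.sort s}
  | _, .app f dom cod t => {Symbol.func f dom cod, Symbol.sort cod} ∪ ⋃ i, (t i).voc

/-- The variables of a term. -/
def vars : {s : N} → Term N s → Set (N × ℕ)
  | _, .var s k => {(s, k)}
  | _, .app _ _ _ t => ⋃ i, (t i).vars

/-- The value of a term under an assignment of the variables. -/
def eval (M : Struct N) (v : ∀ s, ℕ → M.Dom s) : {s : N} → Term N s → M.Dom s
  | _, .var s k => v s k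
  | _, .app f dom cod t => M.func f dom cod fun i => (t i).eval M v

theorem sort_mem_voc {s : N} (t : Term N s) : Symbol.sort s ∈ t.voc := by
  cases t <;> simp [voc]

theorem isVocabulary_voc {s : N} (t : Term N s) : IsVocabulary t.voc := by
  induction t with
  | var s k =>
    refine ⟨⟨_, rfl⟩, ?_, ?_, ?_⟩ <;> intros <;> simp_all [voc]
  | app f dom cod t ih =>
    refine ⟨⟨_, Or.inl (Or.inl rfl)⟩, ?_, ?_, ?_⟩
    · rintro R n dom' ((h | h) | h) i
      · cases h
      · cases h
      · obtain ⟨j, hj⟩ := Set.mem_iUnion.1 h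
        exact Or.inr (Set.mem_iUnion.2 ⟨j, (ih j).rel_dom R dom' hj i⟩)
    · rintro g n dom' cod' ((h | h) | h) i
      · cases h
        exact Or.inr (Set.mem_iUnion.2 ⟨i, sort_mem_voc _⟩)
      · cases h
      · obtain ⟨j, hj⟩ := Set.mem_iUnion.1 h
        exact Or.inr (Set.mem_iUnion.2 ⟨j, (ih j).func_dom g dom' cod' hj i⟩)
    · rintro g n dom' cod' ((h | h) | h)
      · cases h
        exact Or.inl (Or.inr rfl)
      · cases h
      · obtain ⟨j, hj⟩ := Set.mem_iUnion.1 h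
        exact Or.inr (Set.mem_iUnion.2 ⟨j, (ih j).func_cod g dom' cod' hj⟩)

end Term

/-- Many-sorted first-order formulas with equality; `ex s k φ` binds the `k`-th variable of
sort `s`. -/
inductive Formula (N : Type u) : Type u
  | eq {s : N} (t t' : Term N s) : Formula N
  | rel (R : N) {n : ℕ} (dom : Fin n → N) (t : (i : Fin n) → Term N (dom i)) : Formula N
  | neg (φ : Formula N) : Formula N
  | and (φ ψ : Formula N) : Formula N
  | ex (s : N) (k : ℕ) (φ : Formula N) : Formula N

namespace Formula

variable {N : Type u}

/-- The symbols of a formula, including the sorts of its terms and quantifiers. -/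
def voc : Formula N → Set (Symbol N)
  | eq t t' => t.voc ∪ t'.voc
  | rel R dom t => {Symbol.rel R dom} ∪ ⋃ i, (t i).voc
  | neg φ => φ.voc
  | and φ ψ => φ.voc ∪ ψ.voc
  | ex s _ φ => {Symbol.sort s} ∪ φ.voc

/-- The free variables of a formula. -/
def freeVars : Formula N → Set (N × ℕ)
  | eq t t' => t.vars ∪ t'.vars
  | rel _ _ t => ⋃ i, (t i).vars
  | neg φ => φ.freeVars
  | and φ ψ => φ.freeVars ∪ ψ.freeVars
  | ex s k φ => φ.freeVars \ {(s, k)}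

/-- The formula is an equation or a relation symbol applied to terms. -/
def IsAtomic : Formula N → Prop
  | eq _ _ => True
  | rel _ _ _ => True
  | _ => False

open Classical in
/-- Truth of a formula in a structure under an assignment of the variables. -/
def Realize (M : Struct N) : Formula N → (∀ s, ℕ → M.Dom s) → Prop
  | eq t t', v => t.eval M v = t'.eval M v
  | rel R dom t, v => M.rel R dom fun i => (t i).eval M v
  | neg φ, v => ¬ φ.Realize M v
  | and φ ψ, v => φ.Realize M v ∧ ψ.Realize M v
  | ex s k φ, v => ∃ a : M.Dom s, φ.Realize M (Function.update v s (Function.update (v s) k a))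

theorem isVocabulary_union {σ τ : Set (Symbol N)} (h : IsVocabulary σ) (h' : IsVocabulary τ) :
    IsVocabulary (σ ∪ τ) where
  nonempty := h.nonempty.mono Set.subset_union_left
  rel_dom R _ dom hR i := hR.imp (h.rel_dom R dom · i) (h'.rel_dom R dom · i)
  func_dom f _ dom cod hf i := hf.imp (h.func_dom f dom cod · i) (h'.func_dom f dom cod · i)
  func_cod f _ dom cod hf := hf.imp (h.func_cod f dom cod) (h'.func_cod f dom cod)

theorem isVocabulary_voc (φ : Formula N) : IsVocabulary φ.voc := by
  induction φ with
  | eq t t' => exact isVocabulary_union t.isVocabulary_voc t'.isVocabulary_voc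
  | rel R dom t =>
    refine ⟨⟨_, Or.inl rfl⟩, ?_, ?_, ?_⟩
    · rintro R' n dom' (h | h) i
      · cases h
        exact Or.inr (Set.mem_iUnion.2 ⟨i, Term.sort_mem_voc _⟩)
      · obtain ⟨j, hj⟩ := Set.mem_iUnion.1 h
        exact Or.inr (Set.mem_iUnion.2 ⟨j, (t j).isVocabulary_voc.rel_dom R' dom' hj i⟩)
    · rintro g n dom' cod' (h | h) i
      · cases h
      · obtain ⟨j, hj⟩ := Set.mem_iUnion.1 h
        exact Or.inr (Set.mem_iUnion.2 ⟨j, (t j).isVocabulary_voc.func_dom g dom' cod' hj i⟩)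
    · rintro g n dom' cod' (h | h)
      · cases h
      · obtain ⟨j, hj⟩ := Set.mem_iUnion.1 h
        exact Or.inr (Set.mem_iUnion.2 ⟨j, (t j).isVocabulary_voc.func_cod g dom' cod' hj⟩)
  | neg φ ih => exact ih
  | and φ ψ ih ih' => exact isVocabulary_union ih ih'
  | ex s k φ ih =>
    refine isVocabulary_union ((Term.var s k).isVocabulary_voc) ih

end Formula

/-! ## Abstract logics -/

/-- An abstract logic `(S, F, ⊨, τ)` where `S` is the class of all many-sorted structures (with
symbol names from `N`), `F` is `Sentence` and `τ` is `voc`. -/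
structure AbstractLogic (N : Type u) where
  Sentence : Type w
  Sat : Struct N → Sentence → Prop
  voc : Sentence → Set (Symbol N)
  isVocabulary : ∀ φ, IsVocabulary (voc φ)
  voc_subset : ∀ {M : Struct N} {φ : Sentence}, Sat M φ → voc φ ⊆ M.voc

/-- First-order logic `L_ωω` (many-sorted, with equality). -/
def firstOrder (N : Type u) : AbstractLogic.{u, u} N where
  Sentence := {φ : Formula N // φ.freeVars = ∅}
  Sat M φ := φ.1.voc ⊆ M.voc ∧ ∀ v : ∀ s, ℕ → M.Dom s, φ.1.Realize M v
  voc φ := φ.1.voc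
  isVocabulary φ := φ.1.isVocabulary_voc
  voc_subset h := h.1

namespace AbstractLogic

variable {N : Type u}

/-- A set of sentences is consistent if it has a model. -/
def Consistent (L : AbstractLogic.{u, w} N) (T : Set L.Sentence) : Prop :=
  ∃ M : Struct N, ∀ φ ∈ T, L.Sat M φ

/-- A set of sentences is complete if it is the set of all sentences true in some structure. -/
def Complete (L : AbstractLogic.{u, w} N) (T : Set L.Sentence) : Prop :=
  ∃ M : Struct N, T = {φ | L.Sat M φ}

/-- The vocabulary of a set of sentences. -/
def theoryVoc (L : AbstractLogic.{u, w} N) (T : Set L.Sentence) : Set (Symbol N) :=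
  ⋃ φ ∈ T, L.voc φ

/-- The Compactness Theorem holds for `L`. The class of sentences may live in a larger universe
than the domains of the structures; `Small` says that `T` is a set and not a proper class. -/
def Compact (L : AbstractLogic.{u, w} N) : Prop :=
  ∀ T : Set L.Sentence, Small.{u} T →
    (∀ Γ : Set L.Sentence, Γ ⊆ T → Γ.Finite → L.Consistent Γ) → L.Consistent T

/-- Every sentence that has a model has a countable model. -/
def Lowenheim (L : AbstractLogic.{u, w} N) : Prop :=
  ∀ φ : L.Sentence, (∃ M, L.Sat M φ) → ∃ M, L.Sat M φ ∧ M.IsCountable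

/-- The vocabulary of each sentence is finite. -/
def FiniteOccurrence (L : AbstractLogic.{u, w} N) : Prop :=
  ∀ φ : L.Sentence, (L.voc φ).Finite

/-- The Robinson (consistency) property. -/
def Robinson (L : AbstractLogic.{u, w} N) : Prop :=
  ∀ T₀ T₁ T₂ : Set L.Sentence, L.Complete T₀ → L.Consistent T₁ → T₀ ⊆ T₁ → L.Consistent T₂ →
    T₀ ⊆ T₂ → L.theoryVoc T₁ ∩ L.theoryVoc T₂ = L.theoryVoc T₀ → L.Consistent (T₁ ∪ T₂)

/-- `L` is a sublogic of `L'`. -/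
def Sublogic (L : AbstractLogic.{u, w} N) (L' : AbstractLogic.{u, w'} N) : Prop :=
  ∀ φ : L.Sentence, ∃ φ' : L'.Sentence,
    (∀ M, L.Sat M φ ↔ L'.Sat M φ') ∧ L.voc φ = L'.voc φ'

/-- `L ≡ L'`. -/
def Equivalent (L : AbstractLogic.{u, w} N) (L' : AbstractLogic.{u, w'} N) : Prop :=
  L.Sublogic L' ∧ L'.Sublogic L

/-- Regular logics: closure under isomorphisms, reducts and renamings, and the atom, negation,
conjunction, particularization, relativization and substitution properties. -/
structure Regular (L : AbstractLogic.{u, w} N) : Prop where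
  /-- Isomorphism property. -/
  isomorphism_property : ∀ (A B : Struct N) (φ : L.Sentence), A.Iso B → L.Sat A φ → L.Sat B φ
  /-- Reduct property. -/
  reduct_property : ∀ (M : Struct N) (φ : L.Sentence) (h : L.voc φ ⊆ M.voc),
    L.Sat M φ ↔ L.Sat (M.reduct (L.voc φ) (L.isVocabulary φ) h) φ
  /-- Renaming property. -/
  renaming_property : ∀ (τ σ : Set (Symbol N)) (hτ : IsVocabulary τ) (_ : IsVocabulary σ)
    (ρ : Translation N), ρ.IsRenaming τ σ → ∀ φ : L.Sentence, L.voc φ ⊆ τ →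
      ∃ φ' : L.Sentence, L.voc φ' ⊆ σ ∧
        ∀ B : Struct N, B.voc = σ → (L.Sat B φ' ↔ L.Sat (B.unrename ρ τ hτ) φ)
  /-- Atom property. -/
  atom_property : ∀ α : (firstOrder N).Sentence, α.1.IsAtomic →
    ∃ θ : L.Sentence, L.voc θ = (firstOrder N).voc α ∧ ∀ M, L.Sat M θ ↔ (firstOrder N).Sat M α
  /-- Negation property. -/
  negation_property : ∀ φ : L.Sentence, ∃ θ : L.Sentence, L.voc θ = L.voc φ ∧
    ∀ M : Struct N, L.voc φ ⊆ M.voc → (L.Sat M θ ↔ ¬ L.Sat M φ)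
  /-- Conjunction property. -/
  conjunction_property : ∀ φ ψ : L.Sentence, ∃ θ : L.Sentence, L.voc θ = L.voc φ ∪ L.voc ψ ∧
    ∀ M : Struct N, L.Sat M θ ↔ L.Sat M φ ∧ L.Sat M ψ
  /-- Particularization property: `∃ x φ(x)`, with a constant `c` in the role of the variable. -/
  particularization_property : ∀ (φ : L.Sentence) (c s : N), Symbol.const c s ∈ L.voc φ →
    ∃ θ : L.Sentence, L.voc θ = L.voc φ \ {Symbol.const c s} ∧
      ∀ (M : Struct N) (hs : Symbol.sort s ∈ M.voc), M.voc = L.voc φ \ {Symbol.const c s} →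
        (L.Sat M θ ↔ ∃ a : M.Dom s, L.Sat (M.withConst c s hs a) φ)
  /-- Relativization property: if the set `X` of those `a` of sort `s` for which `(M, a) ⊨ χ` is
  the domain of sort `s` of a substructure of `M` (in the vocabulary of `φ`) with the same domains
  as `M` in the other sorts, then `θ` says in `M` that `φ` is true in this substructure.
  The substructure is given by an embedding `e` of a structure `B`. -/
  relativization_property : ∀ (φ χ : L.Sentence) (c s : N), Symbol.sort s ∈ L.voc φ →
    ∃ θ : L.Sentence, L.voc θ ⊆ L.voc φ ∪ (L.voc χ \ {Symbol.const c s}) ∧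
      ∀ (M : Struct N) (hs : Symbol.sort s ∈ M.voc), Symbol.const c s ∉ M.voc →
        L.voc φ ∪ (L.voc χ \ {Symbol.const c s}) ⊆ M.voc →
        ∀ (B : Struct N) (e : ∀ t, B.Dom t → M.Dom t), B.voc = L.voc φ →
          (∀ t, Symbol.sort t ∈ L.voc φ → Function.Injective (e t)) →
          Struct.Respects (L.voc φ) B M e →
          (∀ t, Symbol.sort t ∈ L.voc φ → t ≠ s → Function.Surjective (e t)) →
          Set.range (e s) = {a | L.Sat (M.withConst c s hs a) χ} →
          (L.Sat M θ ↔ L.Sat B φ)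
  /-- Substitution property: `θ` says in `M` that `φ` is true when its relation symbol `R` is
  interpreted by the relation that `χ` defines in `M`; distinct constants `c i` are in the role of
  the variables of `χ`. -/
  substitution_property : ∀ (φ χ : L.Sentence) (R : N) {n : ℕ} (dom c : Fin n → N),
    Symbol.rel R dom ∈ L.voc φ →
    Function.Injective (fun i => Symbol.const (c i) (dom i)) →
    ∃ θ : L.Sentence,
      L.voc θ ⊆ (L.voc φ \ {Symbol.rel R dom}) ∪
        (L.voc χ \ Set.range fun i => Symbol.const (c i) (dom i)) ∧
      ∀ (M : Struct N) (hs : ∀ i, Symbol.sort (dom i) ∈ M.voc), Symbol.rel R dom ∉ M.voc →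
        (∀ i, Symbol.const (c i) (dom i) ∉ M.voc) →
        (L.voc φ \ {Symbol.rel R dom}) ∪
          (L.voc χ \ Set.range fun i => Symbol.const (c i) (dom i)) ⊆ M.voc →
        (L.Sat M θ ↔
          L.Sat (M.withRel R dom hs {a | L.Sat (M.withConsts c dom hs a) χ}) φ)

end AbstractLogic

end ManySorted

/-! The heart is a separation theorem (`exists_separator`): two sentences `φ₁`, `φ₂` of `L` that
share a symbol and have no common model are separated by a first-order sentence in their common
vocabulary. Applied to a sentence and its negation it gives `sublogic_firstOrder`. The opposite
inclusion `firstOrder_sublogic` is an induction on formulas, with fresh constants in the role of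
variables.

Suppose that nothing separates. Over a finite vocabulary, finitely many first-order sentences decide
the Ehrenfeucht–Fraïssé game with `m` rounds (`exists_backForth_formulas`). No Boolean combination
of them separates, so some models of `φ₁` and `φ₂` agree on all of them
(`exists_separator_of_finite`), and the second player wins between these models. After a renaming
that makes them disjoint, both models are put into one structure. A new sort is added whose elements
code partial isomorphisms, arranged in levels by the number of rounds left (`exists_finite_chain`).

The properties of such a chain of levels are first-order and hence expressible in `L`. Compactness
yields an infinite chain, and the union of its levels has the back-and-forth property with respect
to itself (`exists_backForth_system`). That is again a single sentence, so by the Löwenheim property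
it has a countable model. There the codes can be threaded into an isomorphism in the common
vocabulary (`exists_iso`), and gluing along it gives a common model of `φ₁` and `φ₂`
(`exists_common_model`), a contradiction.

For the Robinson property, an inconsistent finite part of the union splits into two conjunctions. A
sentence separating them lies in the vocabulary of the complete theory `T₀`, which therefore decides
it, against the consistency of one of the two sides. -/

namespace ManySorted

variable {N : Type u}

/-! ### Finiteness, dependence on free variables, universal closures -/

namespace Term

theorem voc_finite {s : N} (t : Term N s) : t.voc.Finite := by
  induction t with
  | var s k => exact Set.finite_singleton _
  | app f dom cod t ih => exact (Set.toFinite _).union (Set.finite_iUnion ih)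

theorem vars_finite {s : N} (t : Term N s) : t.vars.Finite := by
  induction t with
  | var s k => exact Set.finite_singleton _
  | app f dom cod t ih => exact Set.finite_iUnion ih

theorem sort_mem_voc_of_mem_vars {s : N} (t : Term N s) {r : N} {k : ℕ} (h : (r, k) ∈ t.vars) :
    Symbol.sort r ∈ t.voc := by
  induction t with
  | var s k =>
    cases h
    rfl
  | app f dom cod t ih =>
    obtain ⟨i, hi⟩ := Set.mem_iUnion.1 h
    exact Or.inr (Set.mem_iUnion.2 ⟨i, ih i hi⟩)

theorem eval_congr (M : Struct N) {v v' : ∀ s, ℕ → M.Dom s} {s : N} (t : Term N s)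
    (h : ∀ r k, (r, k) ∈ t.vars → v r k = v' r k) : t.eval M v = t.eval M v' := by
  induction t with
  | var s k => exact h s k rfl
  | app f dom cod t ih =>
    simp only [eval]
    congr 1
    funext i
    exact ih i fun r k hr => h r k (Set.mem_iUnion.2 ⟨i, hr⟩)

end Term

namespace Formula

theorem voc_finite (φ : Formula N) : φ.voc.Finite := by
  induction φ with
  | eq t t' => exact t.voc_finite.union t'.voc_finite
  | rel R dom t => exact (Set.finite_singleton _).union (Set.finite_iUnion fun i => (t i).voc_finite)
  | neg φ ih => exact ih
  | and φ ψ ih ih' => exact ih.union ih'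
  | ex s k φ ih => exact (Set.finite_singleton _).union ih

theorem freeVars_finite (φ : Formula N) : φ.freeVars.Finite := by
  induction φ with
  | eq t t' => exact t.vars_finite.union t'.vars_finite
  | rel R dom t => exact Set.finite_iUnion fun i => (t i).vars_finite
  | neg φ ih => exact ih
  | and φ ψ ih ih' => exact ih.union ih'
  | ex s k φ ih => exact ih.sdiff

theorem sort_mem_voc_of_mem_freeVars (φ : Formula N) {r : N} {k : ℕ} (h : (r, k) ∈ φ.freeVars) :
    Symbol.sort r ∈ φ.voc := by
  induction φ with
  | eq t t' => exact h.imp t.sort_mem_voc_of_mem_vars t'.sort_mem_voc_of_mem_vars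
  | rel R dom t =>
    obtain ⟨i, hi⟩ := Set.mem_iUnion.1 h
    exact Or.inr (Set.mem_iUnion.2 ⟨i, (t i).sort_mem_voc_of_mem_vars hi⟩)
  | neg φ ih => exact ih h
  | and φ ψ ih ih' => exact h.imp ih ih'
  | ex s k φ ih => exact Or.inr (ih h.1)

theorem realize_congr (M : Struct N) (φ : Formula N) {v v' : ∀ s, ℕ → M.Dom s}
    (h : ∀ r k, (r, k) ∈ φ.freeVars → v r k = v' r k) : φ.Realize M v ↔ φ.Realize M v' := by
  classical
  induction φ generalizing v v' with
  | eq t t' =>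
    simp only [Realize]
    rw [t.eval_congr M fun r k hr => h r k (Or.inl hr),
      t'.eval_congr M fun r k hr => h r k (Or.inr hr)]
  | rel R dom t =>
    simp only [Realize]
    rw [show (fun i => (t i).eval M v) = fun i => (t i).eval M v' from
      funext fun i => (t i).eval_congr M fun r k hr => h r k (Set.mem_iUnion.2 ⟨i, hr⟩)]
  | neg φ ih => exact not_congr (ih h)
  | and φ ψ ih ih' =>
    exact and_congr (ih fun r k hr => h r k (Or.inl hr)) (ih' fun r k hr => h r k (Or.inr hr))
  | ex s k φ ih =>
    refine exists_congr fun a => ih fun r j hr => ?_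
    by_cases hrs : r = s
    · subst hrs
      by_cases hjk : j = k
      · subst hjk
        simp
      · simpa [hjk] using h r j ⟨hr, by simpa using hjk⟩
    · simpa [hrs] using h r j ⟨hr, by simp [hrs]⟩

/-- The universal quantifier. -/
def all (s : N) (k : ℕ) (φ : Formula N) : Formula N := neg (ex s k (neg φ))

/-- Implication. -/
def imp (φ ψ : Formula N) : Formula N := neg (and φ (neg ψ))

/-- Equivalence. -/
def iff (φ ψ : Formula N) : Formula N := and (imp φ ψ) (imp ψ φ)

/-- The implication whose premises are the members of a list. -/
def impList (l : List (Formula N)) (φ : Formula N) : Formula N := l.foldr imp φ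

open Classical in
theorem realize_all (M : Struct N) (s : N) (k : ℕ) (φ : Formula N) (v : ∀ s, ℕ → M.Dom s) :
    (all s k φ).Realize M v ↔
      ∀ a, φ.Realize M (Function.update v s (Function.update (v s) k a)) := by
  simp only [all, Realize, not_exists, not_not]

theorem realize_imp (M : Struct N) (φ ψ : Formula N) (v : ∀ s, ℕ → M.Dom s) :
    (imp φ ψ).Realize M v ↔ (φ.Realize M v → ψ.Realize M v) := by
  simp [imp, Realize]

theorem realize_iff (M : Struct N) (φ ψ : Formula N) (v : ∀ s, ℕ → M.Dom s) :
    (iff φ ψ).Realize M v ↔ (φ.Realize M v ↔ ψ.Realize M v) := by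
  simp only [iff, Realize, realize_imp]
  tauto

theorem realize_impList (M : Struct N) (l : List (Formula N)) (φ : Formula N)
    (v : ∀ s, ℕ → M.Dom s) :
    (impList l φ).Realize M v ↔ ((∀ ψ ∈ l, ψ.Realize M v) → φ.Realize M v) := by
  induction l with
  | nil => simp [impList]
  | cons a l ih =>
    have : impList (a :: l) φ = imp a (impList l φ) := rfl
    rw [this, realize_imp, ih]
    simp

/-- Every formula has a universal closure. -/
theorem exists_closure (φ : Formula N) : ∃ ψ : Formula N, ψ.freeVars = ∅ ∧ ψ.voc = φ.voc ∧
    ∀ M : Struct N, (∀ v, ψ.Realize M v) ↔ ∀ v, φ.Realize M v := by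
  classical
  suffices H : ∀ (F : Finset (N × ℕ)) (φ : Formula N), φ.freeVars ⊆ F →
      ∃ ψ : Formula N, ψ.freeVars = ∅ ∧ ψ.voc = φ.voc ∧
        ∀ M : Struct N, (∀ v, ψ.Realize M v) ↔ ∀ v, φ.Realize M v from
    H φ.freeVars_finite.toFinset φ (by simp)
  intro F
  induction F using Finset.induction_on with
  | empty => exact fun φ h => ⟨φ, by simpa using h, rfl, fun M => Iff.rfl⟩
  | insert x F hx ih =>
    intro φ h
    obtain ⟨s, k⟩ := x
    by_cases hs : (s, k) ∈ φ.freeVars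
    · obtain ⟨ψ, h1, h2, h3⟩ := ih (all s k φ) (by
        intro y hy
        obtain ⟨hy1, hy2⟩ : y ∈ φ.freeVars ∧ y ∉ ({(s, k)} : Set (N × ℕ)) := hy
        have := h hy1
        simp only [Finset.coe_insert, Set.mem_insert_iff] at this
        exact this.resolve_left hy2)
      refine ⟨ψ, h1, h2.trans ?_, fun M => (h3 M).trans ⟨fun H v => ?_, fun H v => ?_⟩⟩
      · exact Set.union_eq_self_of_subset_left
          (Set.singleton_subset_iff.2 (φ.sort_mem_voc_of_mem_freeVars hs))
      · have := (realize_all M s k φ v).1 (H v) (v s k)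
        simpa using this
      · exact (realize_all M s k φ v).2 fun a => H _
    -- Quantifying a variable that is not free could add its sort to the vocabulary, so it is
    -- skipped.
    · refine ih φ fun y hy => ?_
      have := h hy
      simp only [Finset.coe_insert, Set.mem_insert_iff] at this
      exact this.resolve_left fun e => hs (e ▸ hy)

end Formula

/-! ### Expansions, and constants in the role of variables -/

theorem isVocabulary_univ [Nonempty N] : IsVocabulary (Set.univ : Set (Symbol N)) where
  nonempty := ⟨Symbol.sort (Classical.arbitrary N), trivial⟩
  rel_dom _ _ _ _ _ := trivial
  func_dom _ _ _ _ _ _ := trivial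
  func_cod _ _ _ _ _ := trivial

namespace Struct

/-- The expansion of `M` to the vocabulary of all symbols by the invisible part of its
interpretation. -/
def full [Nonempty N] (M : Struct N) : Struct N :=
  { M with voc := Set.univ, isVocabulary := isVocabulary_univ }

theorem respects_of_interp_eq {σ : Set (Symbol N)} (M : Struct N) {τ τ' : Set (Symbol N)}
    {hτ : IsVocabulary τ} {hτ' : IsVocabulary τ'} {I I' : (S : Symbol N) → S.Value M.Dom}
    (h : ∀ S ∈ σ, I S = I' S) :
    Respects σ ⟨τ, hτ, M.Dom, M.nonempty, I⟩ ⟨τ', hτ', M.Dom, M.nonempty, I'⟩ fun _ => id where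
  rel R n dom hR x := by
    simp only [Struct.rel, h _ hR, id]
  func f n dom cod hf x := by
    simp only [Struct.func, h _ hf, id]

open Classical in
/-- `M` with every constant `c k` of sort `s` interpreted by `v s k`. -/
noncomputable def assign [Nonempty N] (M : Struct N) (c : ℕ → N) (v : ∀ s, ℕ → M.Dom s) :
    Struct N where
  voc := Set.univ
  isVocabulary := isVocabulary_univ
  Dom := M.Dom
  nonempty := M.nonempty
  interp
    | .sort _ => PUnit.unit
    | .rel R dom => M.rel R dom
    | .func f (n := n) dom cod => fun x =>
      if h : n = 0 ∧ ∃ k, c k = f then v cod h.2.choose else M.func f dom cod x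

theorem assign_func_const [Nonempty N] (M : Struct N) {c : ℕ → N} (hc : Function.Injective c)
    (v : ∀ s, ℕ → M.Dom s) (s : N) (k : ℕ) (x : ∀ i, M.Dom ((Fin.elim0 : Fin 0 → N) i)) :
    (M.assign c v).func (c k) Fin.elim0 s x = v s k := by
  have h : ∃ j, c j = c k := ⟨k, rfl⟩
  have : h.choose = k := hc h.choose_spec
  simp only [Struct.func, assign]
  rw [dif_pos ⟨rfl, h⟩, this]

theorem assign_func [Nonempty N] (M : Struct N) {c : ℕ → N} (v : ∀ s, ℕ → M.Dom s) (f : N) {n : ℕ}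
    (dom : Fin n → N) (cod : N) (h : ∀ k s, Symbol.func f dom cod ≠ Symbol.const (c k) s)
    (x : ∀ i, M.Dom (dom i)) : (M.assign c v).func f dom cod x = M.func f dom cod x := by
  refine dif_neg ?_
  rintro ⟨rfl, k, rfl⟩
  exact h k cod (by rw [Symbol.const]; congr; exact Subsingleton.elim _ _)

end Struct

/-- Replacement of the variables of index `k` by the constants `c k`. -/
def Term.close (c : ℕ → N) : {s : N} → Term N s → Term N s
  | _, .var s k => .app (c k) Fin.elim0 s fun i => i.elim0
  | _, .app f dom cod t => .app f dom cod fun i => (t i).close c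

/-- The constants that replace the variables in a set. -/
def varConsts (c : ℕ → N) (V : Set (N × ℕ)) : Set (Symbol N) :=
  (fun x => Symbol.const (c x.2) x.1) '' V

theorem Term.vars_close (c : ℕ → N) {s : N} (t : Term N s) : (t.close c).vars = ∅ := by
  induction t with
  | var s k => simp [close, vars]
  | app f dom cod t ih => simp [close, vars, ih]

theorem Term.voc_close (c : ℕ → N) {s : N} (t : Term N s) :
    (t.close c).voc = t.voc ∪ varConsts c t.vars := by
  induction t with
  | var s k =>
    simp [close, voc, vars, varConsts, Symbol.const, Set.insert_def]
  | app f dom cod t ih =>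
    simp only [close, voc, vars, ih, varConsts, Set.image_iUnion, Set.iUnion_union_distrib,
      Set.union_assoc]

theorem Term.eval_close [Nonempty N] {c : ℕ → N} (hc : Function.Injective c) (M : Struct N)
    (v : ∀ s, ℕ → M.Dom s) {s : N} (t : Term N s)
    (h : ∀ k r, Symbol.const (c k) r ∉ t.voc) (w : ∀ s, ℕ → M.Dom s) :
    (t.close c).eval (M.assign c v) w = t.eval M v := by
  induction t with
  | var s k => exact M.assign_func_const hc v s k _
  | app f dom cod t ih =>
    refine (M.assign_func v f dom cod (fun k s e => h k s (Or.inl (Or.inl e.symm))) _).trans ?_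
    refine congrArg (M.func f dom cod) (funext fun i => ?_)
    exact ih i fun k r hk => h k r (Or.inr (Set.mem_iUnion.2 ⟨i, hk⟩))

/-! ### First-order logic inside a regular logic -/

namespace AbstractLogic

variable {L : AbstractLogic.{u, w} N}

/-- Satisfaction of `φ` depends only on the isomorphism type of the reduct to the vocabulary
of `φ`. -/
theorem Regular.sat_of_respects (hL : L.Regular) {A B : Struct N} {φ : L.Sentence}
    (hA : L.voc φ ⊆ A.voc) (hB : L.voc φ ⊆ B.voc) (e : ∀ s, A.Dom s → B.Dom s)
    (he : ∀ s, Symbol.sort s ∈ L.voc φ → Function.Bijective (e s))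
    (hr : Struct.Respects (L.voc φ) A B e) : L.Sat A φ ↔ L.Sat B φ := by
  -- The maps `e` are invertible only in the sorts of the vocabulary. The converse direction comes
  -- from the negation of `φ` instead of an inverse isomorphism.
  suffices H : ∀ ψ : L.Sentence, L.voc ψ = L.voc φ → L.Sat A ψ → L.Sat B ψ by
    refine ⟨H φ rfl, fun h => ?_⟩
    obtain ⟨θ, h1, h2⟩ := hL.negation_property φ
    by_contra hn
    exact (h2 B hB).1 (H θ h1 ((h2 A hA).2 hn)) h
  intro ψ hψ h
  rw [← hψ] at hA hB he hr
  refine (hL.reduct_property B ψ hB).2 ?_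
  refine hL.isomorphism_property (A.reduct _ (L.isVocabulary ψ) hA) _ ψ ⟨rfl, e, he, ?_⟩ ((hL.reduct_property A ψ hA).1 h)
  exact ⟨hr.rel, hr.func⟩

/-- The identity maps form an isomorphism of the reducts. This allows structures on the same domains
to be compared symbol by symbol, whatever they do outside the vocabulary of `φ`. -/
theorem Regular.sat_congr_interp (hL : L.Regular) (M : Struct N) {τ τ' : Set (Symbol N)}
    {hτ : IsVocabulary τ} {hτ' : IsVocabulary τ'} {I I' : (S : Symbol N) → S.Value M.Dom}
    {φ : L.Sentence} (h1 : L.voc φ ⊆ τ) (h2 : L.voc φ ⊆ τ') (h : ∀ S ∈ L.voc φ, I S = I' S) :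
    L.Sat ⟨τ, hτ, M.Dom, M.nonempty, I⟩ φ ↔ L.Sat ⟨τ', hτ', M.Dom, M.nonempty, I'⟩ φ :=
  hL.sat_of_respects (A := ⟨τ, hτ, M.Dom, M.nonempty, I⟩)
    (B := ⟨τ', hτ', M.Dom, M.nonempty, I'⟩) h1 h2 (fun _ => id)
    (fun _ _ => Function.bijective_id) (M.respects_of_interp_eq h)

theorem Regular.sat_full [Nonempty N] (hL : L.Regular) {M : Struct N} {φ : L.Sentence}
    (h : L.voc φ ⊆ M.voc) : L.Sat M.full φ ↔ L.Sat M φ :=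
  hL.sat_congr_interp M (Set.subset_univ _) h fun _ _ => rfl

/-- The particularization property in structures of larger vocabulary. -/
theorem Regular.exists_particularization (hL : L.Regular) (φ : L.Sentence) (c s : N)
    (hc : Symbol.const c s ∈ L.voc φ) :
    ∃ θ : L.Sentence, L.voc θ = L.voc φ \ {Symbol.const c s} ∧
      ∀ (M : Struct N) (hs : Symbol.sort s ∈ M.voc), L.voc θ ⊆ M.voc →
        (L.Sat M θ ↔ ∃ a : M.Dom s, L.Sat (M.withConst c s hs a) φ) := by
  obtain ⟨θ, h1, h2⟩ := hL.particularization_property φ c s hc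
  have hsθ : Symbol.sort s ∈ L.voc θ := by
    rw [h1]
    exact ⟨(L.isVocabulary φ).func_cod _ _ _ hc, fun h => nomatch h⟩
  refine ⟨θ, h1, fun M hs hM => ?_⟩
  rw [hL.reduct_property M θ hM, h2 _ hsθ h1]
  refine exists_congr fun a => ?_
  have hins : L.voc φ ⊆ insert (Symbol.const c s) (L.voc θ) := by
    rw [h1]
    intro S hS
    by_cases hSc : S = Symbol.const c s
    · exact Or.inl hSc
    · exact Or.inr ⟨hS, hSc⟩
  exact hL.sat_congr_interp M hins (hins.trans (Set.insert_subset_insert hM)) fun _ _ => rfl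

/-- A sentence of `L` says in `M` what `φ` says about the assignment `v`, after the variables have
been replaced by constants. -/
theorem Regular.exists_assign [Nonempty N] (hL : L.Regular) {c : ℕ → N}
    (hc : Function.Injective c)
    (φ : Formula N) (h : ∀ k s, Symbol.const (c k) s ∉ φ.voc) :
    ∃ θ : L.Sentence, L.voc θ = φ.voc ∪ varConsts c φ.freeVars ∧
      ∀ (M : Struct N) (v : ∀ s, ℕ → M.Dom s), L.Sat (M.assign c v) θ ↔ φ.Realize M v := by
  classical
  induction φ with
  | @eq s t t' =>
    obtain ⟨θ, h1, h2⟩ := hL.atom_property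
      ⟨.eq (t.close c) (t'.close c), by simp [Formula.freeVars, Term.vars_close]⟩ trivial
    refine ⟨θ, h1.trans ?_, fun M v => (h2 _).trans ?_⟩
    · simp only [firstOrder, Formula.voc, Term.voc_close, Formula.freeVars, varConsts,
        Set.image_union]
      exact Set.union_union_union_comm _ _ _ _
    · simp only [firstOrder, Formula.Realize]
      refine (and_iff_right (Set.subset_univ _)).trans ?_
      have e1 := t.eval_close hc M v fun k r hk => h k r (Or.inl hk)
      have e2 := t'.eval_close hc M v fun k r hk => h k r (Or.inr hk)
      exact ⟨fun H => (e1 v).symm.trans ((H v).trans (e2 v)),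
        fun H w => (e1 w).trans (H.trans (e2 w).symm)⟩
  | rel R dom t =>
    obtain ⟨θ, h1, h2⟩ := hL.atom_property
      ⟨.rel R dom fun i => (t i).close c, by simp [Formula.freeVars, Term.vars_close]⟩ trivial
    refine ⟨θ, h1.trans ?_, fun M v => (h2 _).trans ?_⟩
    · simp only [firstOrder, Formula.voc, Term.voc_close, Formula.freeVars, varConsts,
        Set.image_iUnion, Set.iUnion_union_distrib, Set.union_assoc]
    · simp only [firstOrder, Formula.Realize]
      refine (and_iff_right (Set.subset_univ _)).trans ?_
      have e1 : ∀ w, (fun i => ((t i).close c).eval (M.assign c v) w) = fun i => (t i).eval M v :=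
        fun w => funext fun i =>
          (t i).eval_close hc M v (fun k r hk => h k r (Or.inr (Set.mem_iUnion.2 ⟨i, hk⟩))) w
      constructor
      · intro H
        have := H v
        rw [e1 v] at this
        exact this
      · intro H w
        rw [e1 w]
        exact H
  | neg φ ih =>
    obtain ⟨θ, h1, h2⟩ := ih h
    obtain ⟨θ', h1', h2'⟩ := hL.negation_property θ
    exact ⟨θ', h1'.trans h1,
      fun M v => (h2' (M.assign c v) (Set.subset_univ _)).trans (not_congr (h2 M v))⟩
  | and φ ψ ih ih' =>
    obtain ⟨θ, h1, h2⟩ := ih fun k s hk => h k s (Or.inl hk)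
    obtain ⟨θ', h1', h2'⟩ := ih' fun k s hk => h k s (Or.inr hk)
    obtain ⟨θ'', h1'', h2''⟩ := hL.conjunction_property θ θ'
    refine ⟨θ'', ?_, fun M v => (h2'' _).trans (and_congr (h2 M v) (h2' M v))⟩
    rw [h1'', h1, h1']
    simp only [Formula.voc, Formula.freeVars, varConsts, Set.image_union]
    exact Set.union_union_union_comm _ _ _ _
  | ex s k φ ih =>
    obtain ⟨θ, h1, h2⟩ := ih fun j r hk => h j r (Or.inr hk)
    -- Particularization needs the constant `c k` in the vocabulary. If the variable is not free in
    -- `φ`, it is the conjunct `c k = c k` that puts the constant and its sort there.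
    obtain ⟨ε, h1', h2'⟩ := hL.atom_property
      ⟨.eq ((Term.var s k).close c) ((Term.var s k).close c),
        by simp [Formula.freeVars, Term.vars_close]⟩ trivial
    obtain ⟨θ', h1'', h2''⟩ := hL.conjunction_property θ ε
    have hε : L.voc ε = {Symbol.sort s, Symbol.const (c k) s} := by
      rw [h1']
      simp [firstOrder, Formula.voc, Term.voc_close, Term.voc, Term.vars, varConsts, Set.insert_def, or_comm]
    rw [hε, h1] at h1''
    obtain ⟨θ'', h3, h4⟩ := hL.exists_particularization θ' (c k) s (by rw [h1'']; simp)
    refine ⟨θ'', ?_, fun M v => ?_⟩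
    · rw [h3, h1'']
      ext S
      have hinj : ∀ r j, Symbol.const (c j) r = Symbol.const (c k) s ↔ r = s ∧ j = k := by
        intro r j
        simp only [Symbol.const, Symbol.func.injEq, hc.eq_iff]
        tauto
      by_cases hS : S = Symbol.const (c k) s
      · subst hS
        have := h k s
        simp only [Formula.voc] at this
        simp [Formula.voc, Formula.freeVars, varConsts, hinj]
        simpa using this
      · have hS' : ∀ r j, Symbol.const (c j) r = S → ¬ (r = s ∧ j = k) := by
          rintro r j rfl ⟨rfl, rfl⟩
          exact hS rfl
        simp only [Formula.voc, Formula.freeVars, varConsts, Set.mem_sdiff, Set.mem_union,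
          Set.mem_image, Prod.exists, Set.mem_insert_iff, Set.mem_singleton_iff, hS, or_false,
          not_false_eq_true, and_true, Prod.mk.injEq]
        constructor
        · rintro ((hh | ⟨r, j, hr, rfl⟩) | hh)
          · exact Or.inl (Or.inr hh)
          · exact Or.inr ⟨r, j, ⟨hr, hS' r j rfl⟩, rfl⟩
          · exact Or.inl (Or.inl hh)
        · rintro ((hh | hh) | ⟨r, j, ⟨hr, -⟩, rfl⟩)
          · exact Or.inr hh
          · exact Or.inl (Or.inl hh)
          · exact Or.inl (Or.inr ⟨r, j, hr, rfl⟩)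
    · rw [h4 (M.assign c v) (Set.mem_univ _) (Set.subset_univ _)]
      simp only [Formula.Realize]
      refine exists_congr fun a => ?_
      rw [h2'', and_iff_left, ← h2]
      -- Interpreting `c k` by `a` on top of `M.assign c v` amounts to assigning the updated `v`.
      · refine hL.sat_congr_interp M (fun S _ => Or.inr trivial) (Set.subset_univ _) fun S _ => ?_
        by_cases hS : S = Symbol.const (c k) s
        · subst hS
          rw [Function.update_self]
          funext x
          refine Eq.trans ?_ (M.assign_func_const hc _ s k x).symm
          rw [Function.update_self]
          exact (Function.update_self (f := v s) k a).symm
        · rw [Function.update_of_ne hS]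
          cases S with
          | sort r => rfl
          | rel R dom => rfl
          | func f dom cod =>
            funext x
            simp only [Struct.assign]
            split_ifs with hh
            · obtain ⟨rfl, j, rfl⟩ := hh
              have hj : Exists.choose (⟨j, rfl⟩ : ∃ i, c i = c j) = j :=
                hc (Exists.choose_spec (⟨j, rfl⟩ : ∃ i, c i = c j))
              rw [hj]
              by_cases hcod : cod = s
              · subst hcod
                have : j ≠ k := by
                  rintro rfl
                  refine hS ?_
                  rw [Symbol.const]
                  congr
                  exact Subsingleton.elim _ _
                rw [Function.update_self]
                exact (Function.update_of_ne (f := v cod) this a).symm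
              · simp [hcod]
            · rfl
      · refine (h2' _).2 ⟨?_, fun w => rfl⟩
        intro S hS
        exact Or.inr trivial

theorem exists_injective_notMem [Infinite N] {F : Set N} (hF : F.Finite) :
    ∃ c : ℕ → N, Function.Injective c ∧ ∀ k, c k ∉ F := by
  have : Infinite (Fᶜ : Set N) := hF.infinite_compl.to_subtype
  exact ⟨fun k => (Infinite.natEmbedding (Fᶜ : Set N) k).1,
    Subtype.val_injective.comp (Infinite.natEmbedding _).injective,
    fun k => (Infinite.natEmbedding (Fᶜ : Set N) k).2⟩

/-- First-order logic is a sublogic of every regular logic. -/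
theorem Regular.firstOrder_sublogic [Infinite N] (hL : L.Regular) : (firstOrder N).Sublogic L := by
  rintro ⟨φ, hφ⟩
  have hF : {k : N | ∃ s, Symbol.const k s ∈ φ.voc}.Finite := by
    refine (φ.voc_finite.image fun S => match S with
      | .sort s => s
      | .rel R _ => R
      | .func f _ _ => f).subset ?_
    rintro k ⟨s, hs⟩
    exact ⟨_, hs, rfl⟩
  obtain ⟨c, hc, hcF⟩ := exists_injective_notMem hF
  have hcF' : ∀ k s, Symbol.const (c k) s ∉ φ.voc := fun k s hk => hcF k ⟨s, hk⟩
  obtain ⟨θ, h1, h2⟩ := hL.exists_assign hc φ hcF'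
  have h1' : L.voc θ = φ.voc := by rw [h1, hφ]; simp [varConsts]
  refine ⟨θ, fun M => ?_, h1'.symm⟩
  have key : L.voc θ ⊆ M.voc → ∀ v : ∀ s, ℕ → M.Dom s, L.Sat M θ ↔ φ.Realize M v := by
    intro hM v
    rw [← h2 M v]
    refine hL.sat_congr_interp M hM (Set.subset_univ _) fun S hS => ?_
    cases S with
    | sort r => rfl
    | rel R dom => rfl
    | func f dom cod =>
      funext x
      refine (M.assign_func v f dom cod (fun k s e => hcF' k s ?_) x).symm
      rw [← e, ← h1']
      exact hS
  constructor
  · rintro ⟨hM, H⟩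
    have v : ∀ s, ℕ → M.Dom s := fun s _ => (M.nonempty s).some
    exact (key (h1' ▸ hM) v).2 (H v)
  · intro H
    have hM := L.voc_subset H
    exact ⟨show φ.voc ⊆ _ from h1' ▸ hM, fun v => (key hM v).1 H⟩

/-- Universal closures of first-order formulas in a regular logic. -/
theorem Regular.exists_closure [Infinite N] (hL : L.Regular) (φ : Formula N) :
    ∃ θ : L.Sentence, ∀ M, L.Sat M θ ↔ φ.voc ⊆ M.voc ∧ ∀ v, φ.Realize M v := by
  obtain ⟨ψ, h1, h2, h3⟩ := φ.exists_closure
  obtain ⟨θ, h4, -⟩ := hL.firstOrder_sublogic ⟨ψ, h1⟩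
  refine ⟨θ, fun M => (h4 M).symm.trans ?_⟩
  rw [← h3 M, ← h2]
  rfl

/-- The conjunction starts from `φ` because there is no empty one: the vocabulary of a sentence is
nonempty. -/
theorem Regular.exists_conj (hL : L.Regular) (φ : L.Sentence) {Γ : Set L.Sentence}
    (hΓ : Γ.Finite) :
    ∃ θ : L.Sentence, L.voc θ = L.voc φ ∪ L.theoryVoc Γ ∧
      ∀ M : Struct N, L.Sat M θ ↔ L.Sat M φ ∧ ∀ ψ ∈ Γ, L.Sat M ψ := by
  induction Γ, hΓ using Set.Finite.induction_on with
  | empty => exact ⟨φ, by simp [theoryVoc], by simp⟩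
  | @insert ψ Γ _ _ ih =>
    obtain ⟨θ, h1, h2⟩ := ih
    obtain ⟨θ', h1', h2'⟩ := hL.conjunction_property θ ψ
    refine ⟨θ', ?_, fun M => ?_⟩
    · rw [h1', h1, theoryVoc, theoryVoc, Set.biUnion_insert, Set.union_assoc,
        Set.union_comm (L.voc ψ)]
    · rw [h2', h2]
      simp only [Set.forall_mem_insert]
      tauto

end AbstractLogic

/-! ## Unnested atomic formulas -/

namespace Symbol

/-- The places of the unnested atomic formula of a symbol: two for the equation of a sort, the
argument places for a relation symbol, the argument places and the value for a function symbol. -/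
def Arg : Symbol N → Type
  | .sort _ => Bool
  | .rel _ (n := n) _ => Fin n
  | .func _ (n := n) _ _ => Option (Fin n)

instance (S : Symbol N) : Finite S.Arg := by
  cases S <;> simp only [Arg] <;> infer_instance

/-- The sorts of the places. -/
def argSort : (S : Symbol N) → S.Arg → N
  | .sort s => fun _ => s
  | .rel _ dom => dom
  | .func _ dom cod => fun i => Option.elim i cod dom

theorem sort_argSort_mem {σ : Set (Symbol N)} (hσ : IsVocabulary σ) {S : Symbol N} (hS : S ∈ σ)
    (i : S.Arg) : Symbol.sort (S.argSort i) ∈ σ := by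
  cases S with
  | sort s => exact hS
  | rel R dom => exact hσ.rel_dom R dom hS i
  | func f dom cod =>
    cases i with
    | none => exact hσ.func_cod f dom cod hS
    | some i => exact hσ.func_dom f dom cod hS i

/-- The unnested atomic formula of the symbol that `ρ` assigns to a symbol; the variable at the
place `i` has index `k i`. -/
def atom (ρ : Translation N) : (S : Symbol N) → (S.Arg → ℕ) → Formula N
  | .sort s, k => .eq (.var (ρ.sort s) (k false)) (.var (ρ.sort s) (k true))
  | .rel R dom, k => .rel (ρ.relName R dom) (fun i => ρ.sort (dom i)) fun i => .var _ (k i)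
  | .func f dom cod, k => .eq (.app (ρ.funcName f dom cod) (fun i => ρ.sort (dom i)) (ρ.sort cod)
      fun i => .var _ (k (some i))) (.var _ (k none))

end Symbol

/-- The identical translation. -/
def Translation.id (N : Type u) : Translation N where
  sort s := s
  relName := fun R {_} _ => R
  funcName := fun f {_} _ _ => f

/-- The relation between the elements at the places that the unnested atomic formula of a symbol
expresses. -/
def Struct.Holds (M : Struct N) : (S : Symbol N) → (∀ i, M.Dom (S.argSort i)) → Prop
  | .sort s, x => (show M.Dom s from x false) = x true
  | .rel R dom, x => M.rel R dom x
  | .func f dom cod, x => M.func f dom cod (fun i => x (some i)) = x none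

theorem Symbol.realize_atom [Nonempty N] (ρ : Translation N) (M : Struct N) (S : Symbol N)
    (k : S.Arg → ℕ) (v : ∀ s, ℕ → M.Dom s) :
    (S.atom ρ k).Realize M v ↔ (M.unrename ρ Set.univ isVocabulary_univ).Holds S
      fun i => v (ρ.sort (S.argSort i)) (k i) := by
  cases S <;> rfl

theorem Symbol.realize_atom_id (M : Struct N) (S : Symbol N)
    (k : S.Arg → ℕ) (v : ∀ s, ℕ → M.Dom s) :
    (S.atom (.id N) k).Realize M v ↔ M.Holds S fun i => v (S.argSort i) (k i) := by
  cases S <;> rfl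

theorem Symbol.voc_atom_id_subset {σ : Set (Symbol N)} (hσ : IsVocabulary σ) {S : Symbol N}
    (hS : S ∈ σ) (k : S.Arg → ℕ) : (S.atom (.id N) k).voc ⊆ σ := by
  have h := sort_argSort_mem hσ hS
  cases S with
  | sort s => exact Set.union_subset (Set.singleton_subset_iff.2 hS) (Set.singleton_subset_iff.2 hS)
  | rel R dom =>
    exact Set.union_subset (Set.singleton_subset_iff.2 hS)
      (Set.iUnion_subset fun i => Set.singleton_subset_iff.2 (h i))
  | func f dom cod =>
    exact Set.union_subset (Set.union_subset (Set.pair_subset hS (h none))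
      (Set.iUnion_subset fun i => Set.singleton_subset_iff.2 (h (some i))))
      (Set.singleton_subset_iff.2 (h none))

theorem Symbol.mem_voc_atom_id (S : Symbol N) (k : S.Arg → ℕ) : S ∈ (S.atom (.id N) k).voc := by
  cases S with
  | sort s => exact Or.inl rfl
  | rel R dom => exact Or.inl rfl
  | func f dom cod => exact Or.inl (Or.inl (Or.inl rfl))

theorem Symbol.freeVars_atom_id_subset {V : Set (N × ℕ)} {S : Symbol N} {k : S.Arg → ℕ}
    (h : ∀ i, (S.argSort i, k i) ∈ V) : (S.atom (.id N) k).freeVars ⊆ V := by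
  cases S with
  | sort s =>
    exact Set.union_subset (Set.singleton_subset_iff.2 (h false))
      (Set.singleton_subset_iff.2 (h true))
  | rel R dom => exact Set.iUnion_subset fun i => Set.singleton_subset_iff.2 (h i)
  | func f dom cod =>
    exact Set.union_subset (Set.iUnion_subset fun i => Set.singleton_subset_iff.2 (h (some i)))
      (Set.singleton_subset_iff.2 (h none))

theorem Struct.Respects.holds_iff {σ : Set (Symbol N)} (hσ : IsVocabulary σ) {A B : Struct N}
    {e : ∀ s, A.Dom s → B.Dom s} (h : Respects σ A B e)
    (he : ∀ s, Symbol.sort s ∈ σ → Function.Injective (e s)) {S : Symbol N} (hS : S ∈ σ)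
    (x : ∀ i, A.Dom (S.argSort i)) : A.Holds S x ↔ B.Holds S fun i => e _ (x i) := by
  cases S with
  | sort s => exact (he s hS).eq_iff.symm
  | rel R dom => exact h.rel R dom hS x
  | func f dom cod =>
    refine Iff.trans ?_ (Eq.congr_left (h.func f dom cod hS fun i => x (some i)))
    exact (he cod (hσ.func_cod f dom cod hS)).eq_iff.symm

/-- For a function symbol the place of the value is filled with the value in `A`. The equation then
holds in `A`, and its truth in `B` is compatibility with the function. -/
theorem Struct.respects_of_holds_iff {σ : Set (Symbol N)} {A B : Struct N}
    {e : ∀ s, A.Dom s → B.Dom s}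
    (h : ∀ S ∈ σ, ∀ x, A.Holds S x ↔ B.Holds S fun i => e _ (x i)) : Respects σ A B e where
  rel R n dom hR x := h _ hR x
  func f n dom cod hf x := by
    refine ((h _ hf fun i => match i with
      | none => A.func f dom cod x
      | some i => x i).1 rfl).symm

/-! ## Back-and-forth games -/

/-- The set `p` of pairs preserves the unnested atomic formulas in the vocabulary `σ`. -/
def IsPartialIso (σ : Set (Symbol N)) (A B : Struct N) (p : Set (Σ t, A.Dom t × B.Dom t)) : Prop :=
  ∀ S ∈ σ, ∀ x y, (∀ i, ⟨S.argSort i, x i, y i⟩ ∈ p) → (A.Holds S x ↔ B.Holds S y)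

/-- The second player wins the Ehrenfeucht–Fraïssé game with `r` rounds from position `p`. -/
def BackForth (σ : Set (Symbol N)) (A B : Struct N) :
    ℕ → Set (Σ t, A.Dom t × B.Dom t) → Prop
  | 0, p => IsPartialIso σ A B p
  | r + 1, p => IsPartialIso σ A B p ∧
      (∀ s, Symbol.sort s ∈ σ → ∀ a, ∃ b, BackForth σ A B r (insert ⟨s, a, b⟩ p)) ∧
      (∀ s, Symbol.sort s ∈ σ → ∀ b, ∃ a, BackForth σ A B r (insert ⟨s, a, b⟩ p))

theorem BackForth.isPartialIso {σ : Set (Symbol N)} {A B : Struct N} {r : ℕ}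
    {p : Set (Σ t, A.Dom t × B.Dom t)} (h : BackForth σ A B r p) : IsPartialIso σ A B p := by
  cases r with
  | zero => exact h
  | succ r => exact h.1

/-- The formulas in `Γ` do not distinguish two assignments. -/
def Agree (Γ : Set (Formula N)) (A : Struct N) (v : ∀ s, ℕ → A.Dom s) (B : Struct N)
    (v' : ∀ s, ℕ → B.Dom s) : Prop :=
  ∀ φ ∈ Γ, φ.Realize A v ↔ φ.Realize B v'

theorem Agree.symm {Γ : Set (Formula N)} {A B : Struct N} {v : ∀ s, ℕ → A.Dom s}
    {v' : ∀ s, ℕ → B.Dom s} (h : Agree Γ A v B v') : Agree Γ B v' A v :=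
  fun φ hφ => (h φ hφ).symm

/-- Complete descriptions relative to a finite set of formulas. -/
theorem exists_descriptions {Q : Formula N → Prop} (hneg : ∀ φ, Q φ → Q φ.neg)
    (hand : ∀ φ ψ, Q φ → Q ψ → Q (φ.and ψ))
    (htop : ∃ φ, Q φ ∧ ∀ (M : Struct N) v, φ.Realize M v) {Γ : Set (Formula N)} (hΓ : Γ.Finite)
    (hQ : ∀ φ ∈ Γ, Q φ) :
    ∃ Δ : Set (Formula N), Δ.Finite ∧ (∀ δ ∈ Δ, Q δ) ∧
      (∀ (M : Struct N) v, ∃ δ ∈ Δ, δ.Realize M v) ∧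
      ∀ δ ∈ Δ, ∀ (A B : Struct N) v v', δ.Realize A v → δ.Realize B v' → Agree Γ A v B v' := by
  induction Γ, hΓ using Set.Finite.induction_on with
  | empty =>
    obtain ⟨φ, h1, h2⟩ := htop
    exact ⟨{φ}, Set.finite_singleton _, by simpa, fun M v => ⟨φ, rfl, h2 M v⟩,
      fun _ _ _ _ _ _ _ _ ψ hψ => hψ.elim⟩
  | @insert γ Γ _ _ ih =>
    obtain ⟨Δ, h1, h2, h3, h4⟩ := ih fun φ hφ => hQ φ (Or.inr hφ)
    have hγ := hQ γ (Or.inl rfl)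
    refine ⟨(γ.and '' Δ) ∪ (γ.neg.and '' Δ), (h1.image _).union (h1.image _), ?_, ?_, ?_⟩
    · rintro _ (⟨δ, hδ, rfl⟩ | ⟨δ, hδ, rfl⟩)
      · exact hand _ _ hγ (h2 δ hδ)
      · exact hand _ _ (hneg _ hγ) (h2 δ hδ)
    · intro M v
      obtain ⟨δ, hδ, h⟩ := h3 M v
      by_cases hv : γ.Realize M v
      · exact ⟨_, Or.inl ⟨δ, hδ, rfl⟩, hv, h⟩
      · exact ⟨_, Or.inr ⟨δ, hδ, rfl⟩, hv, h⟩
    · rintro _ (⟨δ, hδ, rfl⟩ | ⟨δ, hδ, rfl⟩) A B v v' hA hB φ (rfl | hφ)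
      · exact iff_of_true hA.1 hB.1
      · exact h4 δ hδ A B v v' hA.2 hB.2 φ hφ
      · exact iff_of_false hA.1 hB.1
      · exact h4 δ hδ A B v v' hA.2 hB.2 φ hφ

-- `Γ'` consists of the formulas `∃ δ` for the complete descriptions `δ` relative to `Γ`. The
-- element `a` satisfies some `δ`, so `∃ δ` is true on the side of `A`, hence on that of `B`, and
-- any witness there serves as `b`.
open Classical in
theorem exists_extension_formulas {σ : Set (Symbol N)} {V : Set (N × ℕ)} {s : N} {k : ℕ}
    (hs : Symbol.sort s ∈ σ) {Γ : Set (Formula N)} (hΓ : Γ.Finite)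
    (hQ : ∀ φ ∈ Γ, φ.voc ⊆ σ ∧ φ.freeVars ⊆ insert (s, k) V) :
    ∃ Γ' : Set (Formula N), Γ'.Finite ∧ (∀ φ ∈ Γ', φ.voc ⊆ σ ∧ φ.freeVars ⊆ V) ∧
      ∀ (A B : Struct N) v v', Agree Γ' A v B v' → ∀ a, ∃ b,
        Agree Γ A (Function.update v s (Function.update (v s) k a))
          B (Function.update v' s (Function.update (v' s) k b)) := by
  obtain ⟨Δ, h1, h2, h3, h4⟩ := exists_descriptions
    (Q := fun φ : Formula N => φ.voc ⊆ σ ∧ φ.freeVars ⊆ insert (s, k) V)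
    (fun φ h => h) (fun φ ψ h h' => ⟨Set.union_subset h.1 h'.1, Set.union_subset h.2 h'.2⟩)
    ⟨.eq (.var s k) (.var s k), ⟨by simpa [Formula.voc, Term.voc] using hs,
      by simp [Formula.freeVars, Term.vars]⟩, fun M v => rfl⟩ hΓ hQ
  refine ⟨Formula.ex s k '' Δ, h1.image _, ?_, ?_⟩
  · rintro _ ⟨δ, hδ, rfl⟩
    refine ⟨Set.union_subset (Set.singleton_subset_iff.2 hs) (h2 δ hδ).1, ?_⟩
    rintro x ⟨hx, hx'⟩
    exact ((h2 δ hδ).2 hx).resolve_left hx'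
  · intro A B v v' h a
    obtain ⟨δ, hδ, hr⟩ := h3 A (Function.update v s (Function.update (v s) k a))
    obtain ⟨b, hb⟩ := (h _ ⟨δ, hδ, rfl⟩).1 ⟨a, hr⟩
    exact ⟨b, h4 δ hδ A B _ _ hr hb⟩

/-- The pairs of values of the variables in `V`. -/
def valuePairs (V : Set (N × ℕ)) (A B : Struct N) (v : ∀ s, ℕ → A.Dom s) (v' : ∀ s, ℕ → B.Dom s) :
    Set (Σ t, A.Dom t × B.Dom t) :=
  (fun x : N × ℕ => ⟨x.1, v x.1 x.2, v' x.1 x.2⟩) '' V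

open Classical in
theorem valuePairs_update {V : Set (N × ℕ)} {A B : Struct N} (v : ∀ s, ℕ → A.Dom s)
    (v' : ∀ s, ℕ → B.Dom s) {s : N} {k : ℕ} (hk : (s, k) ∉ V) (a : A.Dom s) (b : B.Dom s) :
    valuePairs (insert (s, k) V) A B (Function.update v s (Function.update (v s) k a))
        (Function.update v' s (Function.update (v' s) k b)) =
      insert ⟨s, a, b⟩ (valuePairs V A B v v') := by
  unfold valuePairs
  rw [Set.image_insert_eq]
  congr 1
  · simp
  · refine Set.image_congr fun x hx => ?_
    obtain ⟨r, j⟩ := x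
    by_cases hr : r = s
    · subst hr
      have : j ≠ k := fun e => hk (e ▸ hx)
      simp [this]
    · simp [hr]

/-- An unnested atomic formula with variables in `V` is given by a symbol of `σ` and an index for
each of its finitely many places, so there are only finitely many. -/
theorem exists_partialIso_formulas {σ : Set (Symbol N)} (hσ : IsVocabulary σ) (hfin : σ.Finite)
    {V : Set (N × ℕ)} (hV : V.Finite) :
    ∃ Γ : Set (Formula N), Γ.Finite ∧ (∀ φ ∈ Γ, φ.voc ⊆ σ ∧ φ.freeVars ⊆ V) ∧
      ∀ (A B : Struct N) v v', Agree Γ A v B v' → IsPartialIso σ A B (valuePairs V A B v v') := by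
  refine ⟨⋃ S ∈ σ, S.atom (.id N) '' {k | ∀ i, (S.argSort i, k i) ∈ V}, ?_, ?_, ?_⟩
  · refine hfin.biUnion fun S _ => Set.Finite.image _ ?_
    refine (Set.Finite.pi' fun _ => hV.image Prod.snd).subset fun k hk i => ⟨_, hk i, rfl⟩
  · intro φ hφ
    simp only [Set.mem_iUnion] at hφ
    obtain ⟨S, hS, k, hk, rfl⟩ := hφ
    exact ⟨Symbol.voc_atom_id_subset hσ hS k, Symbol.freeVars_atom_id_subset hk⟩
  · intro A B v v' h S hS x y hxy
    have : ∀ i, ∃ k, (S.argSort i, k) ∈ V ∧ v _ k = x i ∧ v' _ k = y i := by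
      intro i
      obtain ⟨⟨r, k⟩, hk, e⟩ := hxy i
      simp only [Sigma.mk.injEq] at e
      obtain ⟨rfl, e⟩ := e
      simp only [heq_eq_eq, Prod.mk.injEq] at e
      exact ⟨k, hk, e.1, e.2⟩
    choose k hk hx hy using this
    obtain rfl : (fun i => v _ (k i)) = x := funext hx
    obtain rfl : (fun i => v' _ (k i)) = y := funext hy
    have := h (S.atom (.id N) k) (Set.mem_biUnion hS ⟨k, hk, rfl⟩)
    rwa [Symbol.realize_atom_id, Symbol.realize_atom_id] at this

/-- Finitely many formulas determine the outcome of the game with `r` rounds. -/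
theorem exists_backForth_formulas {σ : Set (Symbol N)} (hσ : IsVocabulary σ) (hfin : σ.Finite)
    (r : ℕ) : ∀ {V : Set (N × ℕ)}, V.Finite →
    ∃ Γ : Set (Formula N), Γ.Finite ∧ (∀ φ ∈ Γ, φ.voc ⊆ σ ∧ φ.freeVars ⊆ V) ∧
      ∀ (A B : Struct N) v v', Agree Γ A v B v' → BackForth σ A B r (valuePairs V A B v v') := by
  classical
  induction r with
  | zero => exact fun hV => exists_partialIso_formulas hσ hfin hV
  | succ r ih =>
    intro V hV
    obtain ⟨Γ₀, h1, h2, h3⟩ := exists_partialIso_formulas hσ hfin hV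
    -- An index that `V` uses in no sort can record the next move in whichever sort it is made.
    obtain ⟨k, hk⟩ := (hV.image Prod.snd).exists_notMem
    have hkV : ∀ s, (s, k) ∉ V := fun s hs => hk ⟨_, hs, rfl⟩
    -- The second conclusion is the first with the structures exchanged. As agreement is symmetric,
    -- applying `H` to `B` and `A` answers the moves made in `B`.
    have H : ∀ s, ∃ Γ : Set (Formula N), Γ.Finite ∧ (∀ φ ∈ Γ, φ.voc ⊆ σ ∧ φ.freeVars ⊆ V) ∧
        (Symbol.sort s ∈ σ → ∀ (A B : Struct N) v v', Agree Γ A v B v' → ∀ a, ∃ b,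
          BackForth σ A B r (insert ⟨s, a, b⟩ (valuePairs V A B v v')) ∧
          BackForth σ B A r (insert ⟨s, b, a⟩ (valuePairs V B A v' v))) := by
      intro s
      by_cases hs : Symbol.sort s ∈ σ
      · obtain ⟨Γ, g1, g2, g3⟩ := ih (hV.insert (s, k))
        obtain ⟨Γ', g1', g2', g3'⟩ := exists_extension_formulas hs g1 g2
        refine ⟨Γ', g1', g2', fun _ A B v v' h a => ?_⟩
        obtain ⟨b, hb⟩ := g3' A B v v' h a
        refine ⟨b, ?_, ?_⟩
        · rw [← valuePairs_update v v' (hkV s)]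
          exact g3 _ _ _ _ hb
        · rw [← valuePairs_update v' v (hkV s)]
          exact g3 _ _ _ _ hb.symm
      · exact ⟨∅, Set.finite_empty, fun _ h => h.elim, fun h => (hs h).elim⟩
    choose Γ g1 g2 g3 using H
    refine ⟨Γ₀ ∪ ⋃ s ∈ {s | Symbol.sort s ∈ σ}, Γ s, ?_, ?_, ?_⟩
    · have : {s | Symbol.sort s ∈ σ}.Finite :=
        hfin.preimage (Function.Injective.injOn fun _ _ => Symbol.sort.inj)
      exact h1.union (this.biUnion fun s _ => g1 s)
    · rintro φ (hφ | hφ)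
      · exact h2 φ hφ
      · simp only [Set.mem_iUnion] at hφ
        obtain ⟨s, hs, hφ⟩ := hφ
        exact g2 s φ hφ
    · intro A B v v' h
      have hs : ∀ s, Symbol.sort s ∈ σ → Agree (Γ s) A v B v' := fun s hs φ hφ =>
        h φ (Or.inr (Set.mem_biUnion (s := {s | Symbol.sort s ∈ σ}) hs hφ))
      refine ⟨h3 A B v v' fun φ hφ => h φ (Or.inl hφ), fun s hsσ a => ?_, fun s hsσ b => ?_⟩
      · obtain ⟨b, hb, -⟩ := g3 s hsσ A B v v' (hs s hsσ) a
        exact ⟨b, hb⟩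
      · obtain ⟨a, -, ha⟩ := g3 s hsσ B A v' v (hs s hsσ).symm b
        exact ⟨a, ha⟩

/-! ## Transport, gluing and renaming of structures -/

/-- Transport of the interpretation of a symbol along families of maps. -/
def Symbol.Value.map {D E : N → Type u} (f : ∀ s, D s → E s) (f' : ∀ s, E s → D s) :
    (S : Symbol N) → S.Value D → S.Value E
  | .sort _, x => x
  | .rel _ _, r => fun x => r fun i => f' _ (x i)
  | .func _ _ cod, F => fun x => f cod (F fun i => f' _ (x i))

namespace Struct

theorem respects_of_interp_eq_map {σ : Set (Symbol N)} (hσ : IsVocabulary σ) {A C : Struct N}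
    {f : ∀ s, A.Dom s → C.Dom s} {f' : ∀ s, C.Dom s → A.Dom s}
    (hf : ∀ s, Symbol.sort s ∈ σ → Function.LeftInverse (f' s) (f s))
    (hC : ∀ S ∈ σ, C.interp S = Symbol.Value.map f f' S (A.interp S)) : Respects σ A C f where
  rel R n dom hR x := by
    simp only [Struct.rel, hC _ hR, Symbol.Value.map]
    rw [show (fun i => f' (dom i) (f (dom i) (x i))) = x from
      funext fun i => hf _ (hσ.rel_dom R dom hR i) _]
  func F n dom cod hF x := by
    simp only [Struct.func, hC _ hF, Symbol.Value.map]
    rw [show (fun i => f' (dom i) (f (dom i) (x i))) = x from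
      funext fun i => hf _ (hσ.func_dom F dom cod hF i) _]

/-- Two structures that are isomorphic in their common vocabulary have an amalgam. -/
theorem exists_amalgam [Nonempty N] {σ₁ σ₂ : Set (Symbol N)} (h₁ : IsVocabulary σ₁)
    (h₂ : IsVocabulary σ₂) (A B : Struct N) (e : ∀ s, A.Dom s → B.Dom s)
    (he : ∀ s, Symbol.sort s ∈ σ₁ → Symbol.sort s ∈ σ₂ → Function.Bijective (e s))
    (hr : Respects (σ₁ ∩ σ₂) A B e) :
    ∃ (C : Struct N) (f : ∀ s, A.Dom s → C.Dom s) (h : ∀ s, B.Dom s → C.Dom s),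
      C.voc = Set.univ ∧ (∀ s, Symbol.sort s ∈ σ₁ → Function.Bijective (f s)) ∧
      (∀ s, Symbol.sort s ∈ σ₂ → Function.Bijective (h s)) ∧
      Respects σ₁ A C f ∧ Respects σ₂ B C h := by
  classical
  -- The amalgam takes over the domain of `A` in the sorts of `σ₁` and that of `B` in all others. In
  -- a common sort `h` is the inverse of `e`.
  have H : ∀ t, ∃ (X : Type u) (f : A.Dom t → X) (f' : X → A.Dom t) (h : B.Dom t → X)
      (h' : X → B.Dom t), Nonempty X ∧
      (Symbol.sort t ∈ σ₁ → Function.LeftInverse f' f ∧ Function.RightInverse f' f) ∧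
      (Symbol.sort t ∈ σ₂ → Function.LeftInverse h' h ∧ Function.RightInverse h' h) ∧
      (Symbol.sort t ∈ σ₁ → Symbol.sort t ∈ σ₂ → ∀ a, h (e t a) = f a) := by
    intro t
    have := A.nonempty t
    by_cases ht : Symbol.sort t ∈ σ₁
    · refine ⟨A.Dom t, id, id, Function.invFun (e t), e t, A.nonempty t,
        fun _ => ⟨fun _ => rfl, fun _ => rfl⟩, fun ht' => ⟨?_, ?_⟩, fun _ ht' a => ?_⟩
      · exact Function.rightInverse_invFun (he t ht ht').2
      · exact Function.leftInverse_invFun (he t ht ht').1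
      · exact Function.leftInverse_invFun (he t ht ht').1 a
    · exact ⟨B.Dom t, e t, fun _ => (A.nonempty t).some, id, id, B.nonempty t,
        fun h => (ht h).elim, fun _ => ⟨fun _ => rfl, fun _ => rfl⟩, fun h => (ht h).elim⟩
  choose X f f' h h' hX hf hh hc using H
  let C : Struct N :=
    { voc := Set.univ
      isVocabulary := isVocabulary_univ
      Dom := X
      nonempty := hX
      interp := fun S => if S ∈ σ₁ then Symbol.Value.map f f' S (A.interp S)
        else Symbol.Value.map h h' S (B.interp S) }
  have hA : Respects σ₁ A C f :=
    respects_of_interp_eq_map (f' := f') h₁ (fun s hs => (hf s hs).1) fun S hS => if_pos hS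
  have hB : Respects (σ₂ \ σ₁) B C h := by
    constructor
    · intro R n dom hR x
      have : C.interp (.rel R dom) = Symbol.Value.map h h' _ (B.interp (.rel R dom)) :=
        if_neg hR.2
      simp only [Struct.rel, this, Symbol.Value.map]
      rw [show (fun i => h' (dom i) (h (dom i) (x i))) = x from
        funext fun i => (hh _ (h₂.rel_dom R dom hR.1 i)).1 _]
    · intro F n dom cod hF x
      have : C.interp (.func F dom cod) = Symbol.Value.map h h' _ (B.interp (.func F dom cod)) :=
        if_neg hF.2
      simp only [Struct.func, this, Symbol.Value.map]
      rw [show (fun i => h' (dom i) (h (dom i) (x i))) = x from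
        funext fun i => (hh _ (h₂.func_dom F dom cod hF.1 i)).1 _]
  refine ⟨C, f, h, rfl, fun s hs => ⟨(hf s hs).1.injective, (hf s hs).2.surjective⟩,
    fun s hs => ⟨(hh s hs).1.injective, (hh s hs).2.surjective⟩, hA, ?_⟩
  constructor
  · intro R n dom hR y
    -- `C` interprets a common symbol as `A` does. The arguments `y` are pulled back along `e`, and
    -- `hr` compares `A` with `B`.
    by_cases hR1 : Symbol.rel R dom ∈ σ₁
    · have : ∀ i, ∃ x, e (dom i) x = y i := fun i =>
        (he _ (h₁.rel_dom R dom hR1 i) (h₂.rel_dom R dom hR i)).2 _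
      choose x hx using this
      obtain rfl : (fun i => e (dom i) (x i)) = y := funext hx
      rw [← hr.rel R dom ⟨hR1, hR⟩ x, hA.rel R dom hR1 x]
      simp only [hc _ (h₁.rel_dom R dom hR1 _) (h₂.rel_dom R dom hR _)]
    · exact hB.rel R dom ⟨hR, hR1⟩ y
  · intro F n dom cod hF y
    by_cases hF1 : Symbol.func F dom cod ∈ σ₁
    · have : ∀ i, ∃ x, e (dom i) x = y i := fun i =>
        (he _ (h₁.func_dom F dom cod hF1 i) (h₂.func_dom F dom cod hF i)).2 _
      choose x hx using this
      obtain rfl : (fun i => e (dom i) (x i)) = y := funext hx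
      rw [← hr.func F dom cod ⟨hF1, hF⟩ x,
        hc _ (h₁.func_cod F dom cod hF1) (h₂.func_cod F dom cod hF), hA.func F dom cod hF1 x]
      simp only [hc _ (h₁.func_dom F dom cod hF1 _) (h₂.func_dom F dom cod hF _)]
    · exact hB.func F dom cod ⟨hF, hF1⟩ y

end Struct

/-- The translation that replaces the names of sorts and relation symbols by their images
under `g`. -/
def Translation.ofNames (g : N → N) : Translation N where
  sort := g
  relName := fun R {_} _ => g R
  funcName := fun f {_} _ _ => f

theorem Translation.onSymbol_ofNames_injective {g : N → N} (hg : Function.Injective g) :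
    Function.Injective (Translation.ofNames g).onSymbol := by
  have hc : ∀ n, Function.Injective fun (d : Fin n → N) i => g (d i) := fun n d d' h =>
    funext fun i => hg (congrFun h i)
  intro S T h
  cases S <;> cases T <;> simp only [onSymbol, ofNames, Symbol.sort.injEq, Symbol.rel.injEq,
    Symbol.func.injEq, reduceCtorEq] at h ⊢
  · exact hg h
  · obtain ⟨h1, rfl, h2⟩ := h
    exact ⟨hg h1, rfl, heq_of_eq (hc _ (eq_of_heq h2))⟩
  · obtain ⟨h1, rfl, h2, h3⟩ := h
    exact ⟨h1, rfl, heq_of_eq (hc _ (eq_of_heq h2)), hg h3⟩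

theorem IsVocabulary.image_ofNames {τ : Set (Symbol N)} (hτ : IsVocabulary τ) (g : N → N) :
    IsVocabulary ((Translation.ofNames g).onSymbol '' τ) where
  nonempty := hτ.nonempty.image _
  rel_dom := by
    rintro R n dom ⟨S, hS, h⟩ i
    cases S <;> simp only [Translation.onSymbol, Symbol.rel.injEq, reduceCtorEq] at h
    obtain ⟨rfl, rfl, h⟩ := h
    cases h
    exact ⟨_, hτ.rel_dom _ _ hS i, rfl⟩
  func_dom := by
    rintro f n dom cod ⟨S, hS, h⟩ i
    cases S <;> simp only [Translation.onSymbol, Symbol.func.injEq, reduceCtorEq] at h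
    obtain ⟨rfl, rfl, h, rfl⟩ := h
    cases h
    exact ⟨_, hτ.func_dom _ _ _ hS i, rfl⟩
  func_cod := by
    rintro f n dom cod ⟨S, hS, h⟩
    cases S <;> simp only [Translation.onSymbol, Symbol.func.injEq, reduceCtorEq] at h
    obtain ⟨rfl, rfl, h, rfl⟩ := h
    exact ⟨_, hτ.func_cod _ _ _ hS, rfl⟩

/-- The structure that interprets each symbol as `B` interprets its translation along `g`. -/
def Struct.along [Nonempty N] (B : Struct N) (g : N → N) : Struct N :=
  B.unrename (.ofNames g) Set.univ isVocabulary_univ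

/-- With `g'` a left inverse of an injective `g`, every structure arises, up to expansion, as the
part of another structure that is read along `g`. -/
theorem Struct.along_along_of_leftInverse [Nonempty N] (A : Struct N) {g g' : N → N}
    (h : Function.LeftInverse g' g) : (A.along g').along g = A.full := by
  have h1 : (A.along g').along g = A.along (g' ∘ g) := by
    simp only [along, unrename]
    congr 1
  rw [h1, h.id]
  simp only [along, unrename, full]
  congr 1
  funext S
  cases S <;> rfl

theorem Struct.Respects.along [Nonempty N] {τ : Set (Symbol N)} {A B : Struct N} {g : N → N}
    {e : ∀ s, A.Dom s → B.Dom s} (h : Respects ((Translation.ofNames g).onSymbol '' τ) A B e) :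
    Respects τ (A.along g) (B.along g) fun s => e (g s) where
  rel R _ dom hR x := h.rel (g R) (fun i => g (dom i)) ⟨_, hR, rfl⟩ x
  func f _ dom cod hf x := h.func f (fun i => g (dom i)) (g cod) ⟨_, hf, rfl⟩ x

/-- What `φ` says about the part of `C` read along `g` becomes a statement about `C` itself. In this
way one structure can speak about two. -/
theorem AbstractLogic.Regular.exists_rename [Nonempty N] {L : AbstractLogic.{u, w} N}
    (hL : L.Regular) {g : N → N} (hg : Function.Injective g) (φ : L.Sentence) :
    ∃ φ' : L.Sentence, L.voc φ' ⊆ (Translation.ofNames g).onSymbol '' L.voc φ ∧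
      ∀ C : Struct N, L.voc φ' ⊆ C.voc → (L.Sat C φ' ↔ L.Sat (C.along g) φ) := by
  have hσ := (L.isVocabulary φ).image_ofNames g
  obtain ⟨φ', h1, h2⟩ := hL.renaming_property _ _ (L.isVocabulary φ) hσ (.ofNames g)
    ((Translation.onSymbol_ofNames_injective hg).injOn.bijOn_image) φ subset_rfl
  refine ⟨φ', h1, fun C hC => ?_⟩
  refine (hL.sat_congr_interp C hC h1 (hτ' := hσ) fun S _ => rfl).trans ((h2 _ rfl).trans ?_)
  exact hL.sat_congr_interp (C.along g) subset_rfl (Set.subset_univ _) fun S _ => rfl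

/-! ## Structures of partial maps -/

namespace Struct

/-- The `i`-th subset of the sort `p`. -/
def subsetRel (M : Struct N) (p i : N) (x : M.Dom p) : Prop :=
  M.rel i ![p] (Fin.cons (α := fun j => M.Dom (![p] j)) x finZeroElim)

/-- The binary relation on the sort `p`. -/
def extRel (M : Struct N) (p o : N) (x y : M.Dom p) : Prop :=
  M.rel o ![p, p] (Fin.cons (α := fun j => M.Dom (![p, p] j)) x (Fin.cons y finZeroElim))

/-- The relation between the sorts `s` and `t` that is coded by an element of the sort `p`. -/
def graphRel (M : Struct N) (p o s t : N) (x : M.Dom p) (a : M.Dom s) (b : M.Dom t) : Prop :=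
  M.rel o ![p, s, t] (Fin.cons (α := fun j => M.Dom (![p, s, t] j)) x
    (Fin.cons a (Fin.cons b finZeroElim)))

open Classical in
/-- Addition of a sort whose elements code the members of a family of partial maps. -/
theorem exists_coding [Nonempty N] {σ : Set (Symbol N)} (hσ : IsVocabulary σ) (C : Struct N)
    (g : N → N) {p : N} (o : N) (hp : Symbol.sort p ∉ σ) {P : Type u} [Nonempty P]
    (J : N → P → Prop) (le : P → P → Prop) (G : P → Set (Σ t, C.Dom t × C.Dom (g t))) :
    ∃ (D : Struct N) (f : ∀ s, C.Dom s → D.Dom s) (q : D.Dom p → P),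
      D.voc = Set.univ ∧ (∀ s, Symbol.sort s ∈ σ → Function.Bijective (f s)) ∧
      Respects σ C D f ∧ Function.Surjective q ∧
      (∀ i x, D.subsetRel p i x ↔ J i (q x)) ∧
      (∀ x y, D.extRel p o x y ↔ le (q x) (q y)) ∧
      ∀ s, Symbol.sort s ∈ σ → Symbol.sort (g s) ∈ σ → ∀ x a b,
        D.graphRel p o s (g s) x (f s a) (f (g s) b) ↔ ⟨s, a, b⟩ ∈ G (q x) := by
  -- Only the domain of sort `p` is replaced, namely by `P`; `q` is of interest in that sort alone.
  have H : ∀ t, ∃ (X : Type u) (f : C.Dom t → X) (f' : X → C.Dom t) (q : X → P), Nonempty X ∧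
      (Symbol.sort t ∈ σ → Function.LeftInverse f' f ∧ Function.RightInverse f' f) ∧
      (t = p → Function.Surjective q) := by
    intro t
    by_cases ht : t = p
    · subst ht
      exact ⟨P, fun _ => Classical.arbitrary P, fun _ => (C.nonempty t).some, id, inferInstance,
        fun h => (hp h).elim, fun _ => Function.surjective_id⟩
    · exact ⟨C.Dom t, id, id, fun _ => Classical.arbitrary P, C.nonempty t,
        fun _ => ⟨fun _ => rfl, fun _ => rfl⟩, fun h => (ht h).elim⟩
  choose X f f' q hX hf hq using H
  -- The name `o` can serve the binary relation and all graphs at once, since symbols with different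
  -- argument sorts are different. In the ternary case elements are compared together with their
  -- sorts, as the argument sorts of an arbitrary symbol need not be related by `g`.
  let new : (S : Symbol N) → S.Value X
    | .sort _ => PUnit.unit
    | .rel R (n := 1) dom => fun x => J R (q _ (x 0))
    | .rel _ (n := 2) dom => fun x => le (q _ (x 0)) (q _ (x 1))
    | .rel _ (n := 3) dom => fun x => ∃ z ∈ G (q _ (x 0)),
        (⟨z.1, z.2.1⟩ : Σ t, C.Dom t) = ⟨dom 1, f' _ (x 1)⟩ ∧
        (⟨g z.1, z.2.2⟩ : Σ t, C.Dom t) = ⟨dom 2, f' _ (x 2)⟩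
    | .rel _ _ => fun _ => False
    | .func _ _ cod => fun _ => (hX cod).some
  let D : Struct N :=
    { voc := Set.univ
      isVocabulary := isVocabulary_univ
      Dom := X
      nonempty := hX
      interp := fun S => if S ∈ σ then Symbol.Value.map f f' S (C.interp S) else new S }
  -- A relation symbol whose first argument has sort `p` cannot belong to the vocabulary `σ`, so its
  -- interpretation is free to be chosen.
  have hnew : ∀ (R : N) {n : ℕ} (dom : Fin (n + 1) → N), dom 0 = p →
      D.interp (.rel R dom) = new (.rel R dom) := fun R n dom h0 =>
    if_neg fun h => hp (h0 ▸ hσ.rel_dom R dom h 0)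
  refine ⟨D, f, q p, rfl, fun s hs => ⟨(hf s hs).1.injective, (hf s hs).2.surjective⟩,
    respects_of_interp_eq_map (f' := f') hσ (fun s hs => (hf s hs).1) fun S hS => if_pos hS,
    hq p rfl, ?_, ?_, ?_⟩
  · intro i x
    simp only [subsetRel, Struct.rel, hnew i ![p] rfl]
    exact Iff.rfl
  · intro x y
    simp only [extRel, Struct.rel, hnew o ![p, p] rfl]
    exact Iff.rfl
  · intro s hs hgs x a b
    simp only [graphRel, Struct.rel, hnew o ![p, s, g s] rfl]
    have key : (∃ z ∈ G (q p x), (⟨z.1, z.2.1⟩ : Σ t, C.Dom t) = ⟨s, f' s (f s a)⟩ ∧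
        (⟨g z.1, z.2.2⟩ : Σ t, C.Dom t) = ⟨g s, f' (g s) (f (g s) b)⟩) ↔ ⟨s, a, b⟩ ∈ G (q p x) := by
      rw [(hf s hs).1 a, (hf _ hgs).1 b]
      constructor
      · rintro ⟨⟨t, a', b'⟩, hz, h1, h2⟩
        simp only [Sigma.mk.injEq] at h1
        obtain ⟨rfl, h1⟩ := h1
        cases h1
        cases h2
        exact hz
      · exact fun h => ⟨_, h, rfl, rfl⟩
    exact key

end Struct

/-- Indices that differ across all sorts prevent a clash even where some of the sorts `σ j`
coincide. -/
theorem Struct.exists_assignment (M : Struct N) {ι : Type*} (σ : ι → N) {k : ι → ℕ}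
    (hk : Function.Injective k) (x : ∀ j, M.Dom (σ j)) :
    ∃ v : ∀ s, ℕ → M.Dom s, ∀ j, v (σ j) (k j) = x j := by
  have H : ∀ s n, ∃ a : M.Dom s, ∀ j (h : σ j = s), k j = n → h ▸ x j = a := by
    intro s n
    by_cases h : ∃ j, σ j = s ∧ k j = n
    · obtain ⟨j, rfl, rfl⟩ := h
      refine ⟨x j, fun j' h hj => ?_⟩
      cases hk hj
      rfl
    · exact ⟨(M.nonempty s).some, fun j h' hj => (h ⟨j, h', hj⟩).elim⟩
  choose v hv using H
  exact ⟨v, fun j => (hv _ _ j rfl rfl).symm⟩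

open Classical in
theorem update_update_self {D : N → Type u} (v : ∀ s, ℕ → D s) (s : N) (k : ℕ) (a : D s) :
    Function.update v s (Function.update (v s) k a) s k = a := by
  simp

open Classical in
theorem update_update_of_ne {D : N → Type u} (v : ∀ s, ℕ → D s) (s : N) {k : ℕ} (a : D s) (r : N)
    {j : ℕ} (h : j ≠ k) : Function.update v s (Function.update (v s) k a) r j = v r j := by
  by_cases hr : r = s
  · subst hr
    simp [h]
  · simp [hr]

/-! ## Sentences about coded partial maps -/

namespace Formula

/-- A relation symbol applied to variables. -/
def relVar (R : N) {n : ℕ} (dom : Fin n → N) (k : Fin n → ℕ) : Formula N :=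
  .rel R dom fun i => .var (dom i) (k i)

theorem realize_subsetRel (M : Struct N) (p i : N) (x : ℕ) (v : ∀ s, ℕ → M.Dom s) :
    (relVar i ![p] ![x]).Realize M v ↔ M.subsetRel p i (v p x) := by
  refine iff_of_eq (congrArg (M.rel i ![p]) (funext fun j => ?_))
  fin_cases j
  rfl

theorem realize_extRel (M : Struct N) (p o : N) (x y : ℕ) (v : ∀ s, ℕ → M.Dom s) :
    (relVar o ![p, p] ![x, y]).Realize M v ↔ M.extRel p o (v p x) (v p y) := by
  refine iff_of_eq (congrArg (M.rel o ![p, p]) (funext fun j => ?_))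
  fin_cases j <;> rfl

theorem realize_graphRel (M : Struct N) (p o s t : N) (x k l : ℕ) (v : ∀ s, ℕ → M.Dom s) :
    (relVar o ![p, s, t] ![x, k, l]).Realize M v ↔ M.graphRel p o s t (v p x) (v s k) (v t l) := by
  refine iff_of_eq (congrArg (M.rel o ![p, s, t]) (funext fun j => ?_))
  fin_cases j <;> rfl

end Formula

namespace Struct

variable (M : Struct N) (p o : N) (g : N → N)

/-- The coded partial maps preserve the unnested atomic formula of `S`. -/
def Preserves [Nonempty N] (S : Symbol N) : Prop :=
  ∀ (z : M.Dom p) (x : ∀ i, M.Dom (S.argSort i)) (y : ∀ i, M.Dom (g (S.argSort i))),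
    (∀ i, M.graphRel p o _ _ z (x i) (y i)) → (M.Holds S x ↔ (M.along g).Holds S y)

/-- The binary relation on codes implies extension of the coded maps in the sort `s`. -/
def Extends (s : N) : Prop :=
  ∀ (z z' : M.Dom p) (a : M.Dom s) (b : M.Dom (g s)), M.extRel p o z z' →
    M.graphRel p o s (g s) z a b → M.graphRel p o s (g s) z' a b

/-- The forth property from the `i`-th to the `j`-th set of codes in the sort `s`. -/
def Forth (s i j : N) : Prop :=
  ∀ (z : M.Dom p) (a : M.Dom s), M.subsetRel p i z →
    ∃ z', M.subsetRel p j z' ∧ M.extRel p o z z' ∧ ∃ b, M.graphRel p o s (g s) z' a b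

/-- The back property from the `i`-th to the `j`-th set of codes in the sort `s`. -/
def Back (s i j : N) : Prop :=
  ∀ (z : M.Dom p) (b : M.Dom (g s)), M.subsetRel p i z →
    ∃ z', M.subsetRel p j z' ∧ M.extRel p o z z' ∧ ∃ a, M.graphRel p o s (g s) z' a b

end Struct

namespace AbstractLogic

variable {L : AbstractLogic.{u, w} N}

/-- A property of the structures with all symbols is expressed by a sentence. -/
def Expressible (L : AbstractLogic.{u, w} N) (Q : Struct N → Prop) : Prop :=
  ∃ θ : L.Sentence, ∀ M : Struct N, M.voc = Set.univ → (L.Sat M θ ↔ Q M)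

/-- The free variables of `φ` are read universally, so the formulas below need no outer quantifiers.
-/
theorem Regular.expressible [Infinite N] (hL : L.Regular) {Q : Struct N → Prop} (φ : Formula N)
    (h : ∀ M, (∀ v, φ.Realize M v) ↔ Q M) : L.Expressible Q := by
  obtain ⟨θ, hθ⟩ := hL.exists_closure φ
  refine ⟨θ, fun M hM => (hθ M).trans ?_⟩
  rw [hM, and_iff_right (Set.subset_univ _), h]

/-- Here and in the next two lemmas the indices 0 and 1 belong to codes, 2 to an element of sort `s`
and 3 to one of sort `g s`. -/
theorem Regular.expressible_extends [Infinite N] (hL : L.Regular) (p o : N) (g : N → N) (s : N) :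
    L.Expressible fun M => M.Extends p o g s := by
  refine hL.expressible (.imp (.relVar o ![p, p] ![0, 1]) (.imp
    (.relVar o ![p, s, g s] ![0, 2, 3]) (.relVar o ![p, s, g s] ![1, 2, 3]))) fun M => ?_
  simp only [Formula.realize_imp, Formula.realize_extRel, Formula.realize_graphRel]
  constructor
  · intro h z z' a b
    obtain ⟨v, hv⟩ := M.exists_assignment ![p, p, s, g s] Fin.val_injective
      (Fin.cons (α := fun j => M.Dom (![p, p, s, g s] j)) z
        (Fin.cons z' (Fin.cons a (Fin.cons b finZeroElim))))
    have h0 : v p 0 = z := hv 0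
    have h1 : v p 1 = z' := hv 1
    have h2 : v s 2 = a := hv 2
    have h3 : v (g s) 3 = b := hv 3
    simpa only [h0, h1, h2, h3] using h v
  · exact fun h v => h _ _ _ _

theorem Regular.expressible_forth [Infinite N] (hL : L.Regular) (p o : N) (g : N → N) (s i j : N) :
    L.Expressible fun M => M.Forth p o g s i j := by
  refine hL.expressible (.imp (.relVar i ![p] ![0]) (.ex p 1 (.and (.relVar j ![p] ![1])
    (.and (.relVar o ![p, p] ![0, 1]) (.ex (g s) 3 (.relVar o ![p, s, g s] ![1, 2, 3]))))))
    fun M => ?_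
  simp only [Formula.realize_imp, Formula.Realize, Formula.realize_extRel,
    Formula.realize_graphRel, Formula.realize_subsetRel, update_update_self,
    update_update_of_ne _ _ _ _ (show (0 : ℕ) ≠ 1 by decide),
    update_update_of_ne _ _ _ _ (show (1 : ℕ) ≠ 3 by decide),
    update_update_of_ne _ _ _ _ (show (2 : ℕ) ≠ 1 by decide),
    update_update_of_ne _ _ _ _ (show (2 : ℕ) ≠ 3 by decide)]
  constructor
  · intro h z a
    obtain ⟨v, hv⟩ := M.exists_assignment ![p, s] (k := ![0, 2]) (by decide)
      (Fin.cons (α := fun j => M.Dom (![p, s] j)) z (Fin.cons a finZeroElim))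
    have h0 : v p 0 = z := hv 0
    have h2 : v s 2 = a := hv 1
    simpa only [h0, h2] using h v
  · exact fun h v => h _ _

theorem Regular.expressible_back [Infinite N] (hL : L.Regular) (p o : N) (g : N → N) (s i j : N) :
    L.Expressible fun M => M.Back p o g s i j := by
  refine hL.expressible (.imp (.relVar i ![p] ![0]) (.ex p 1 (.and (.relVar j ![p] ![1])
    (.and (.relVar o ![p, p] ![0, 1]) (.ex s 2 (.relVar o ![p, s, g s] ![1, 2, 3]))))))
    fun M => ?_
  simp only [Formula.realize_imp, Formula.Realize, Formula.realize_extRel,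
    Formula.realize_graphRel, Formula.realize_subsetRel, update_update_self,
    update_update_of_ne _ _ _ _ (show (0 : ℕ) ≠ 1 by decide),
    update_update_of_ne _ _ _ _ (show (1 : ℕ) ≠ 2 by decide),
    update_update_of_ne _ _ _ _ (show (3 : ℕ) ≠ 1 by decide),
    update_update_of_ne _ _ _ _ (show (3 : ℕ) ≠ 2 by decide)]
  constructor
  · intro h z b
    obtain ⟨v, hv⟩ := M.exists_assignment ![p, g s] (k := ![0, 3]) (by decide)
      (Fin.cons (α := fun j => M.Dom (![p, g s] j)) z (Fin.cons b finZeroElim))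
    have h0 : v p 0 = z := hv 0
    have h3 : v (g s) 3 = b := hv 1
    simpa only [h0, h3] using h v
  · exact fun h v => h _ _

theorem Regular.expressible_nonempty [Infinite N] (hL : L.Regular) (p i : N) :
    L.Expressible fun M => ∃ z, M.subsetRel p i z := by
  refine hL.expressible (.ex p 0 (.relVar i ![p] ![0])) fun M => ?_
  simp only [Formula.Realize, Formula.realize_subsetRel, update_update_self]
  have : Nonempty (∀ s, ℕ → M.Dom s) := ⟨fun s _ => (M.nonempty s).some⟩
  exact forall_const _

theorem Regular.expressible_preserves [Infinite N] (hL : L.Regular) (p o : N) (g : N → N)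
    (S : Symbol N) : L.Expressible fun M => M.Preserves p o g S := by
  have := Fintype.ofFinite S.Arg
  obtain ⟨d, hd⟩ : ∃ d : S.Arg → ℕ, Function.Injective d :=
    ⟨_, Fin.val_injective.comp (Finite.equivFin S.Arg).injective⟩
  -- The code has index 0, the arguments in the original sorts have odd indices, those in the
  -- renamed sorts positive even ones.
  refine hL.expressible (.impList (Finset.univ.toList.map fun i : S.Arg =>
      .relVar o ![p, S.argSort i, g (S.argSort i)] ![0, 2 * d i + 1, 2 * d i + 2])
    (.iff (S.atom (.id N) fun i => 2 * d i + 1) (S.atom (.ofNames g) fun i => 2 * d i + 2)))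
    fun M => ?_
  simp only [Formula.realize_impList, Formula.realize_iff, List.mem_map, Finset.mem_toList,
    Finset.mem_univ, true_and, forall_exists_index, forall_apply_eq_imp_iff,
    Formula.realize_graphRel, Symbol.realize_atom_id]
  simp only [Symbol.realize_atom]
  constructor
  · intro h z x y
    obtain ⟨v, hv⟩ := M.exists_assignment
      (fun j : Option (S.Arg ⊕ S.Arg) =>
        j.elim p (Sum.elim S.argSort fun i => g (S.argSort i)))
      (k := fun j => j.elim 0 (Sum.elim (fun i => 2 * d i + 1) fun i => 2 * d i + 2))
      (by
        rintro (_ | i | i) (_ | j | j) hij <;> simp only [Option.elim, Sum.elim_inl,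
          Sum.elim_inr] at hij
        · rfl
        · omega
        · omega
        · omega
        · rw [hd (show d i = d j by omega)]
        · omega
        · omega
        · omega
        · rw [hd (show d i = d j by omega)])
      (fun j => match j with
        | none => z
        | some (.inl i) => x i
        | some (.inr i) => y i)
    have h0 : v p 0 = z := hv none
    have h1 : ∀ i, v (S.argSort i) (2 * d i + 1) = x i := fun i => hv (some (.inl i))
    have h2 : ∀ i, v (g (S.argSort i)) (2 * d i + 2) = y i := fun i => hv (some (.inr i))
    have := h v
    simp only [h0, h1, h2] at this
    intro hxy
    refine (this hxy).trans (iff_of_eq ?_)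
    exact congrArg ((M.along g).Holds S) (funext h2)
  · exact fun h v => h _ _ _

end AbstractLogic

/-! ### Systems of codes and the countable back-and-forth argument -/

theorem Struct.Respects.mono {σ τ : Set (Symbol N)} (h : σ ⊆ τ) {A B : Struct N}
    {e : ∀ s, A.Dom s → B.Dom s} (hr : Struct.Respects τ A B e) : Struct.Respects σ A B e :=
  ⟨fun R _ dom hR => hr.rel R dom (h hR), fun f _ dom cod hf => hr.func f dom cod (h hf)⟩

theorem IsVocabulary.inter {σ τ : Set (Symbol N)} (hσ : IsVocabulary σ) (hτ : IsVocabulary τ)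
    {S : Symbol N} (hS : S ∈ σ) (hS' : S ∈ τ) : IsVocabulary (σ ∩ τ) where
  nonempty := ⟨_, hS, hS'⟩
  rel_dom R _ dom hR i := ⟨hσ.rel_dom R dom hR.1 i, hτ.rel_dom R dom hR.2 i⟩
  func_dom f _ dom cod hf i := ⟨hσ.func_dom f dom cod hf.1 i, hτ.func_dom f dom cod hf.2 i⟩
  func_cod f _ dom cod hf := ⟨hσ.func_cod f dom cod hf.1, hτ.func_cod f dom cod hf.2⟩

/-- The elements of `p` code partial isomorphisms, and the relation between codes implies
extension. -/
structure Struct.IsSystem [Nonempty N] (σ : Set (Symbol N)) (p o : N) (g : N → N) (D : Struct N) :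
    Prop where
  preserves : ∀ S ∈ σ, D.Preserves p o g S
  extend : ∀ s, Symbol.sort s ∈ σ → D.Extends p o g s

/-- The countable back-and-forth argument. -/
theorem Struct.IsSystem.exists_iso [Nonempty N] {σ : Set (Symbol N)} (hσ : IsVocabulary σ) {p o : N} {g : N → N}
    {D : Struct N} (hD : D.IsSystem σ p o g) {i : N}
    (hforth : ∀ s, Symbol.sort s ∈ σ → D.Forth p o g s i i)
    (hback : ∀ s, Symbol.sort s ∈ σ → D.Back p o g s i i) (hne : ∃ z, D.subsetRel p i z)
    (hc : Countable (Σ s : {s // Symbol.sort s ∈ σ}, D.Dom s.1 ⊕ D.Dom (g s.1))) :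
    ∃ e : ∀ s, D.Dom s → D.Dom (g s),
      (∀ s, Symbol.sort s ∈ σ → Function.Bijective (e s)) ∧ Respects σ D (D.along g) e := by
  classical
  obtain ⟨z₀, hz₀⟩ := hne
  let Z := {z : D.Dom p // D.subsetRel p i z}
  -- The order is inclusion of graphs and not `extRel`, which is not assumed to be reflexive or
  -- transitive.
  let _ : Preorder Z :=
    { le := fun z z' => ∀ s, Symbol.sort s ∈ σ → ∀ a b,
        D.graphRel p o s (g s) z.1 a b → D.graphRel p o s (g s) z'.1 a b
      le_refl := fun _ _ _ _ _ h => h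
      le_trans := fun _ _ _ h h' s hs a b hab => h' s hs a b (h s hs a b hab) }
  let _ := Encodable.ofCountable (Σ s : {s // Symbol.sort s ∈ σ}, D.Dom s.1 ⊕ D.Dom (g s.1))
  -- Each element of either side gives a requirement, that it occur in the coded map. Forth and back
  -- make every requirement cofinal, and being countably many they are all met by one ideal.
  let cof : (Σ s : {s // Symbol.sort s ∈ σ}, D.Dom s.1 ⊕ D.Dom (g s.1)) → Order.Cofinal Z :=
    fun x =>
      { carrier := {z | match x with
          | ⟨s, .inl a⟩ => ∃ b, D.graphRel p o s.1 (g s.1) z.1 a b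
          | ⟨s, .inr b⟩ => ∃ a, D.graphRel p o s.1 (g s.1) z.1 a b}
        isCofinal := by
          intro z
          obtain ⟨s, a | b⟩ := x
          · obtain ⟨z', h1, h2, h3⟩ := hforth s.1 s.2 z.1 a z.2
            exact ⟨⟨z', h1⟩, h3, fun t ht a b => hD.extend t ht _ _ a b h2⟩
          · obtain ⟨z', h1, h2, h3⟩ := hback s.1 s.2 z.1 b z.2
            exact ⟨⟨z', h1⟩, h3, fun t ht a b => hD.extend t ht _ _ a b h2⟩ }
  let I := Order.idealOfCofinals ⟨z₀, hz₀⟩ cof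
  have hI := Order.cofinal_meets_idealOfCofinals (⟨z₀, hz₀⟩ : Z) cof
  have htot : ∀ s, Symbol.sort s ∈ σ → ∀ a, ∃ b, ∃ z ∈ I, D.graphRel p o s (g s) z.1 a b := by
    intro s hs a
    obtain ⟨z, ⟨b, hb⟩, hz⟩ := hI ⟨⟨s, hs⟩, .inl a⟩
    exact ⟨b, z, hz, hb⟩
  have hsurj : ∀ s, Symbol.sort s ∈ σ → ∀ b, ∃ a, ∃ z ∈ I, D.graphRel p o s (g s) z.1 a b := by
    intro s hs b
    obtain ⟨z, ⟨a, ha⟩, hz⟩ := hI ⟨⟨s, hs⟩, .inr b⟩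
    exact ⟨a, z, hz, ha⟩
  -- The finitely many pairs at the places of `S` lie in the graph of a single code, because `I` is
  -- directed.
  have hdir : ∀ S ∈ σ, ∀ (x : ∀ i, D.Dom (S.argSort i)) (y : ∀ i, D.Dom (g (S.argSort i))),
      (∀ i, ∃ z ∈ I, D.graphRel p o _ _ z.1 (x i) (y i)) →
      (D.Holds S x ↔ (D.along g).Holds S y) := by
    intro S hS x y hxy
    choose z hzI hz using hxy
    have hd : Directed (· ≤ ·) (Subtype.val : I → Z) := by
      intro a b
      obtain ⟨c, hc, h1, h2⟩ := I.directed a.1 a.2 b.1 b.2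
      exact ⟨⟨c, hc⟩, h1, h2⟩
    have : Nonempty I := ⟨⟨_, Order.mem_idealOfCofinals _ _⟩⟩
    obtain ⟨c, hc⟩ := hd.finite_le fun i => (⟨z i, hzI i⟩ : I)
    exact hD.preserves S hS c.1.1 x y fun i => hc i _ (Symbol.sort_argSort_mem hσ hS i) _ _ (hz i)
  have H : ∀ s, ∃ e : D.Dom s → D.Dom (g s), Symbol.sort s ∈ σ →
      ∀ a, ∃ z ∈ I, D.graphRel p o s (g s) z.1 a (e a) := by
    intro s
    by_cases hs : Symbol.sort s ∈ σ
    · choose e he using htot s hs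
      exact ⟨e, fun _ => he⟩
    · exact ⟨fun _ => (D.nonempty _).some, fun h => (hs h).elim⟩
  choose e he using H
  -- The unnested atomic formula of a sort is an equation. Its preservation makes the union of the
  -- graphs single-valued and injective.
  have heq : ∀ s (hs : Symbol.sort s ∈ σ) a a' b b',
      (∃ z ∈ I, D.graphRel p o s (g s) z.1 a b) → (∃ z ∈ I, D.graphRel p o s (g s) z.1 a' b') →
      (a = a' ↔ b = b') := by
    intro s hs a a' b b' h h'
    refine hdir (.sort s) hs (@Bool.rec (fun _ => D.Dom s) a a')
      (@Bool.rec (fun _ => D.Dom (g s)) b b') ?_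
    rintro (_ | _)
    · exact h
    · exact h'
  refine ⟨e, fun s hs => ⟨fun a a' haa => ?_, fun b => ?_⟩, ?_⟩
  · exact (heq s hs a a' _ _ (he s hs a) (he s hs a')).2 haa
  · obtain ⟨a, ha⟩ := hsurj s hs b
    exact ⟨a, (heq s hs a a _ _ (he s hs a) ha).1 rfl⟩
  · refine Struct.respects_of_holds_iff fun S hS x => ?_
    exact hdir S hS x _ fun i => he _ (Symbol.sort_argSort_mem hσ hS i) (x i)

namespace AbstractLogic

variable {L : AbstractLogic.{u, w} N}

theorem Regular.sat_iff_of_bijective (hL : L.Regular) {A B : Struct N} {φ : L.Sentence}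
    (hA : L.voc φ ⊆ A.voc) (hB : B.voc = Set.univ) {e : ∀ s, A.Dom s → B.Dom s}
    {σ : Set (Symbol N)} (hσ : L.voc φ ⊆ σ)
    (he : ∀ s, Symbol.sort s ∈ σ → Function.Bijective (e s))
    (hr : Struct.Respects σ A B e) : L.Sat A φ ↔ L.Sat B φ :=
  hL.sat_of_respects hA (hB ▸ Set.subset_univ _) e (fun s hs => he s (hσ hs)) (hr.mono hσ)

/-- A family of partial isomorphisms between the two parts of a structure can be coded in a
structure. -/
theorem Regular.exists_system [Nonempty N] (hL : L.Regular) {φ₁ φ₂ : L.Sentence} {g : N → N}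
    {p : N} (o : N) (hp₁ : Symbol.sort p ∉ L.voc φ₁) (hp₂ : ∀ s, g s ≠ p)
    (hσ : IsVocabulary (L.voc φ₁ ∩ L.voc φ₂)) {C : Struct N} (hC : C.voc = Set.univ)
    (h₁ : L.Sat C φ₁) (h₂ : L.Sat (C.along g) φ₂) {P : Type u} [Nonempty P] (J : N → P → Prop)
    (le : P → P → Prop) (G : P → Set (Σ t, C.Dom t × C.Dom (g t)))
    (hG : ∀ z, IsPartialIso (L.voc φ₁ ∩ L.voc φ₂) C (C.along g) (G z))
    (hle : ∀ z z', le z z' → G z ⊆ G z') :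
    ∃ D : Struct N, D.voc = Set.univ ∧ L.Sat D φ₁ ∧ L.Sat (D.along g) φ₂ ∧
      D.IsSystem (L.voc φ₁ ∩ L.voc φ₂) p o g ∧
      (∀ i, (∃ z, J i z) → ∃ z, D.subsetRel p i z) ∧
      ∀ s, Symbol.sort s ∈ L.voc φ₁ ∩ L.voc φ₂ → ∀ i j,
        ((∀ z a, J i z → ∃ z', J j z' ∧ le z z' ∧ ∃ b, ⟨s, a, b⟩ ∈ G z') → D.Forth p o g s i j) ∧
        ((∀ z b, J i z → ∃ z', J j z' ∧ le z z' ∧ ∃ a, ⟨s, a, b⟩ ∈ G z') →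
          D.Back p o g s i j) := by
  -- This is the part of `C` that matters to `φ₁` and, through `g`, to `φ₂`; the coding has to leave
  -- it intact.
  set σ := L.voc φ₁ ∪ (Translation.ofNames g).onSymbol '' L.voc φ₂ with hσ'
  have hσv : IsVocabulary σ :=
    Formula.isVocabulary_union (L.isVocabulary φ₁) ((L.isVocabulary φ₂).image_ofNames g)
  have hp : Symbol.sort p ∉ σ := by
    rintro (h | ⟨S, hS, h⟩)
    · exact hp₁ h
    · cases S <;> simp only [Translation.onSymbol, Symbol.sort.injEq, reduceCtorEq] at h
      exact hp₂ _ h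
  obtain ⟨D, f, q, hD, hf, hr, hq, hU, hE, hGr⟩ :=
    Struct.exists_coding hσv C g o hp J le G
  have hrg : Struct.Respects (L.voc φ₂) (C.along g) (D.along g) fun s => f (g s) :=
    (hr.mono Set.subset_union_right).along
  have hs₁ : ∀ s, Symbol.sort s ∈ L.voc φ₁ → Symbol.sort s ∈ σ := fun s hs => Or.inl hs
  have hs₂ : ∀ s, Symbol.sort s ∈ L.voc φ₂ → Symbol.sort (g s) ∈ σ :=
    fun s hs => Or.inr ⟨_, hs, rfl⟩
  have hGr' : ∀ s, Symbol.sort s ∈ L.voc φ₁ ∩ L.voc φ₂ → ∀ x a b,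
      D.graphRel p o s (g s) x (f s a) (f (g s) b) ↔ ⟨s, a, b⟩ ∈ G (q x) := fun s hs =>
    hGr s (hs₁ s hs.1) (hs₂ s hs.2)
  refine ⟨D, hD, (hL.sat_iff_of_bijective (hC ▸ Set.subset_univ _) hD Set.subset_union_left hf
    hr).1 h₁, (hL.sat_iff_of_bijective (A := C.along g) (Set.subset_univ _) rfl subset_rfl
      (fun s hs => hf _ (hs₂ s hs)) hrg).1 h₂, ⟨?_, ?_⟩, ?_, ?_⟩
  · intro S hS z x y hxy
    have hsort := Symbol.sort_argSort_mem hσ hS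
    have hx : ∀ i, ∃ a, f (S.argSort i) a = x i := fun i => (hf _ (hs₁ _ (hsort i).1)).2 _
    have hy : ∀ i, ∃ b, f (g (S.argSort i)) b = y i := fun i => (hf _ (hs₂ _ (hsort i).2)).2 _
    choose a ha using hx
    choose b hb using hy
    obtain rfl : (fun i => f _ (a i)) = x := funext ha
    obtain rfl : (fun i => f _ (b i)) = y := funext hb
    have e1 := hr.holds_iff hσv (fun s hs => (hf s hs).1) (Or.inl hS.1) a
    have e2 := hrg.holds_iff (L.isVocabulary φ₂) (fun s hs => (hf _ (hs₂ s hs)).1) hS.2 b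
    exact e1.symm.trans ((hG (q z) S hS a b fun i => (hGr' _ (hsort i) _ _ _).1 (hxy i)).trans e2)
  · intro s hs z z' a b hzz hab
    obtain ⟨a, rfl⟩ := (hf s (hs₁ s hs.1)).2 a
    obtain ⟨b, rfl⟩ := (hf _ (hs₂ s hs.2)).2 b
    exact (hGr' s hs _ _ _).2 (hle _ _ ((hE _ _).1 hzz) ((hGr' s hs _ _ _).1 hab))
  · rintro i ⟨z, hz⟩
    obtain ⟨x, rfl⟩ := hq z
    exact ⟨x, (hU i x).2 hz⟩
  · refine fun s hs i j => ⟨fun h x a hx => ?_, fun h x b hx => ?_⟩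
    · obtain ⟨a, rfl⟩ := (hf s (hs₁ s hs.1)).2 a
      obtain ⟨z', h1, h2, b, hb⟩ := h (q x) a ((hU i x).1 hx)
      obtain ⟨x', rfl⟩ := hq z'
      exact ⟨x', (hU j x').2 h1, (hE _ _).2 h2, f _ b, (hGr' s hs _ _ _).2 hb⟩
    · obtain ⟨b, rfl⟩ := (hf _ (hs₂ s hs.2)).2 b
      obtain ⟨z', h1, h2, a, ha⟩ := h (q x) b ((hU i x).1 hx)
      obtain ⟨x', rfl⟩ := hq z'
      exact ⟨x', (hU j x').2 h1, (hE _ _).2 h2, f _ a, (hGr' s hs _ _ _).2 ha⟩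

end AbstractLogic

/-! ## Boolean combinations of first-order sentences -/

/-- Satisfaction quantifies over all assignments. The negation behaves as expected because
assignments exist and a sentence has the same truth value under all of them. -/
theorem firstOrder_neg (γ : (firstOrder N).Sentence) : ∃ θ : (firstOrder N).Sentence,
    (firstOrder N).voc θ = (firstOrder N).voc γ ∧
    ∀ M : Struct N, (firstOrder N).voc γ ⊆ M.voc →
      ((firstOrder N).Sat M θ ↔ ¬ (firstOrder N).Sat M γ) := by
  obtain ⟨γ, hγ⟩ := γ
  refine ⟨⟨γ.neg, hγ⟩, rfl, fun M hM => ?_⟩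
  have v : ∀ s, ℕ → M.Dom s := fun s _ => (M.nonempty s).some
  constructor
  · exact fun h h' => h.2 v (h'.2 v)
  · refine fun h => ⟨hM, fun w hw => h ⟨hM, fun w' => ?_⟩⟩
    exact (γ.realize_congr M fun r k hr => by simp [hγ] at hr).1 hw

theorem firstOrder_and (γ δ : (firstOrder N).Sentence) : ∃ θ : (firstOrder N).Sentence,
    (firstOrder N).voc θ = (firstOrder N).voc γ ∪ (firstOrder N).voc δ ∧
    ∀ M : Struct N,
      (firstOrder N).Sat M θ ↔ (firstOrder N).Sat M γ ∧ (firstOrder N).Sat M δ := by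
  obtain ⟨γ, hγ⟩ := γ
  obtain ⟨δ, hδ⟩ := δ
  refine ⟨⟨γ.and δ, by simp [Formula.freeVars, hγ, hδ]⟩, rfl, fun M => ?_⟩
  simp only [firstOrder, Formula.voc, Set.union_subset_iff, Formula.Realize, forall_and]
  tauto

/-- A valid first-order sentence with given finite vocabulary. -/
theorem exists_valid {σ : Set (Symbol N)} (hσ : IsVocabulary σ) (hfin : σ.Finite) :
    ∃ θ : (firstOrder N).Sentence, (firstOrder N).voc θ = σ ∧
      ∀ M : Struct N, σ ⊆ M.voc → (firstOrder N).Sat M θ := by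
  suffices H : ∀ Γ : Set (Symbol N), Γ.Finite → Γ ⊆ σ →
      ∃ φ : Formula N, Γ ⊆ φ.voc ∧ φ.voc ⊆ σ ∧ ∀ (M : Struct N) v, φ.Realize M v by
    obtain ⟨φ, h1, h2, h3⟩ := H σ hfin subset_rfl
    obtain ⟨ψ, g1, g2, g3⟩ := φ.exists_closure
    have hψ : ψ.voc = σ := g2.trans (h2.antisymm h1)
    exact ⟨⟨ψ, g1⟩, hψ, fun M hM => ⟨hψ.subset.trans hM, (g3 M).2 (h3 M)⟩⟩
  -- An unnested atomic formula of `S` that implies itself is valid and mentions `S`.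
  have hS : ∀ S ∈ σ, ∃ φ : Formula N, S ∈ φ.voc ∧ φ.voc ⊆ σ ∧ ∀ (M : Struct N) v,
      φ.Realize M v := fun S hS =>
    ⟨.imp (S.atom (.id N) fun _ => 0) (S.atom (.id N) fun _ => 0),
      Or.inl (S.mem_voc_atom_id _), Set.union_subset (Symbol.voc_atom_id_subset hσ hS _)
        (Symbol.voc_atom_id_subset hσ hS _), fun M v => (Formula.realize_imp _ _ _ _).2 fun h => h⟩
  intro Γ hΓ
  induction Γ, hΓ using Set.Finite.induction_on with
  | empty =>
    intro _
    obtain ⟨S, h⟩ := hσ.nonempty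
    obtain ⟨φ, -, h2, h3⟩ := hS S h
    exact ⟨φ, Set.empty_subset _, h2, h3⟩
  | @insert S Γ _ _ ih =>
    intro h
    obtain ⟨φ, h1, h2, h3⟩ := hS S (h (Or.inl rfl))
    obtain ⟨ψ, g1, g2, g3⟩ := ih fun T hT => h (Or.inr hT)
    refine ⟨φ.and ψ, ?_, Set.union_subset h2 g2, fun M v => ⟨h3 M v, g3 M v⟩⟩
    exact Set.insert_subset (Or.inl h1) (g1.trans Set.subset_union_right)

/-- Two classes of structures that are separated by the truth values of finitely many first-order
sentences are separated by a single one. -/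
theorem exists_separator_of_finite {σ : Set (Symbol N)} (hσ : IsVocabulary σ)
    (hfin : σ.Finite) {Γ : Set (firstOrder N).Sentence} (hΓ : Γ.Finite) :
    (∀ γ ∈ Γ, (firstOrder N).voc γ ⊆ σ) → ∀ {K₁ K₂ : Struct N → Prop},
    (∀ M, K₁ M → σ ⊆ M.voc) → (∀ M, K₂ M → σ ⊆ M.voc) →
    (∀ A B, K₁ A → K₂ B → ∃ γ ∈ Γ, ¬ ((firstOrder N).Sat A γ ↔ (firstOrder N).Sat B γ)) →
    ∃ θ : (firstOrder N).Sentence, (firstOrder N).voc θ ⊆ σ ∧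
      (∀ M, K₁ M → (firstOrder N).Sat M θ) ∧ ∀ M, K₂ M → ¬ (firstOrder N).Sat M θ := by
  induction Γ, hΓ using Set.Finite.induction_on with
  | empty =>
    intro _ K₁ K₂ h₁ h₂ h
    obtain ⟨θ, hθ, hv⟩ := exists_valid hσ hfin
    -- No sentence is available to tell members of the two classes apart, so one class is empty, and
    -- a valid sentence or its negation separates them.
    by_cases hK : ∃ A, K₁ A
    · obtain ⟨A, hA⟩ := hK
      refine ⟨θ, hθ.subset, fun M hM => hv M (h₁ M hM), fun B hB => ?_⟩
      obtain ⟨γ, hγ, -⟩ := h A B hA hB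
      exact hγ.elim
    · obtain ⟨θ', hθ', hv'⟩ := firstOrder_neg θ
      refine ⟨θ', (hθ'.trans hθ).subset, fun M hM => (hK ⟨M, hM⟩).elim, fun M hM h => ?_⟩
      exact (hv' M (hθ.subset.trans (h₂ M hM))).1 h (hv M (h₂ M hM))
  | @insert γ Γ _ _ ih =>
    intro hvoc K₁ K₂ h₁ h₂ h
    have hγ := hvoc γ (Or.inl rfl)
    have hΓ := fun δ hδ => hvoc δ (Or.inr hδ)
    obtain ⟨θ, a1, a2, a3⟩ := ih hΓ (K₁ := fun M => K₁ M ∧ (firstOrder N).Sat M γ)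
      (K₂ := fun M => K₂ M ∧ (firstOrder N).Sat M γ) (fun M hM => h₁ M hM.1)
      (fun M hM => h₂ M hM.1) (by
        intro A B hA hB
        obtain ⟨δ, rfl | hδ, hd⟩ := h A B hA.1 hB.1
        · exact (hd (iff_of_true hA.2 hB.2)).elim
        · exact ⟨δ, hδ, hd⟩)
    obtain ⟨η, b1, b2, b3⟩ := ih hΓ (K₁ := fun M => K₁ M ∧ ¬ (firstOrder N).Sat M γ)
      (K₂ := fun M => K₂ M ∧ ¬ (firstOrder N).Sat M γ) (fun M hM => h₁ M hM.1)
      (fun M hM => h₂ M hM.1) (by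
        intro A B hA hB
        obtain ⟨δ, rfl | hδ, hd⟩ := h A B hA.1 hB.1
        · exact (hd (iff_of_false hA.2 hB.2)).elim
        · exact ⟨δ, hδ, hd⟩)
    -- `θ` separates among the models of `γ` and `η` among the others. The separator `κ` expresses
    -- `(γ → θ) ∧ (¬γ → η)`.
    obtain ⟨γ', c1, c2⟩ := firstOrder_neg γ
    obtain ⟨θ', d1, d2⟩ := firstOrder_neg θ
    obtain ⟨η', e1, e2⟩ := firstOrder_neg η
    obtain ⟨α, f1, f2⟩ := firstOrder_and γ θ'
    obtain ⟨β, g1, g2⟩ := firstOrder_and γ' η'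
    obtain ⟨α', i1, i2⟩ := firstOrder_neg α
    obtain ⟨β', j1, j2⟩ := firstOrder_neg β
    obtain ⟨κ, k1, k2⟩ := firstOrder_and α' β'
    have hα : (firstOrder N).voc α ⊆ σ := by
      rw [f1, d1]
      exact Set.union_subset hγ a1
    have hβ : (firstOrder N).voc β ⊆ σ := by
      rw [g1, c1, e1]
      exact Set.union_subset hγ b1
    have key : ∀ M : Struct N, σ ⊆ M.voc → ((firstOrder N).Sat M κ ↔
        ((firstOrder N).Sat M γ → (firstOrder N).Sat M θ) ∧
        (¬ (firstOrder N).Sat M γ → (firstOrder N).Sat M η)) := by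
      intro M hM
      rw [k2, i2 M (hα.trans hM), j2 M (hβ.trans hM), f2, g2, c2 M (hγ.trans hM),
        d2 M (a1.trans hM), e2 M (b1.trans hM)]
      tauto
    refine ⟨κ, ?_, fun M hM => (key M (h₁ M hM)).2 ⟨fun h => a2 M ⟨hM, h⟩, fun h => b2 M ⟨hM, h⟩⟩,
      fun M hM hk => ?_⟩
    · rw [k1, i1, j1]
      exact Set.union_subset hα hβ
    · obtain ⟨h3, h4⟩ := (key M (h₂ M hM)).1 hk
      by_cases hg : (firstOrder N).Sat M γ
      · exact a3 M ⟨hM, hg⟩ (h3 hg)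
      · exact b3 M ⟨hM, hg⟩ (h4 hg)

/-- Fresh names for a sort and for a disjoint copy of all sorts and relation symbols. -/
theorem exists_fresh_names [Infinite N] {σ : Set (Symbol N)} (hσ : σ.Finite) :
    ∃ (p : N) (g : N → N), Function.Injective g ∧ Symbol.sort p ∉ σ ∧ (∀ s, g s ≠ p) ∧
      ∀ S, (Translation.ofNames g).onSymbol S ∉ σ := by
  let name : Symbol N → N
    | .sort s => s
    | .rel R _ => R
    -- `Translation.ofNames` keeps the names of function symbols, so a renamed function symbol is
    -- recognized as new by its value sort.
    | .func _ _ cod => cod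
  obtain ⟨p, hp⟩ := (hσ.image name).exists_notMem
  have hF : (insert p (name '' σ)).Finite := (hσ.image name).insert p
  -- An infinite set keeps its cardinality when finitely many names are removed, so there is room
  -- for a copy of every name.
  obtain ⟨e⟩ : Nonempty (N ≃ ((insert p (name '' σ))ᶜ : Set N)) := by
    rw [← Cardinal.eq, ← hF.coe_toFinset]
    exact (Cardinal.mk_compl_finset_of_infinite _).symm
  have he : ∀ s, (e s).1 ∉ insert p (name '' σ) := fun s => (e s).2
  refine ⟨p, fun s => (e s).1, Subtype.val_injective.comp e.injective,
    fun h => hp ⟨_, h, rfl⟩, fun s hs => he s (Or.inl hs), fun S hS => ?_⟩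
  cases S with
  | sort s => exact he s (Or.inr ⟨_, hS, rfl⟩)
  | rel R dom => exact he R (Or.inr ⟨_, hS, rfl⟩)
  | func f dom cod => exact he cod (Or.inr ⟨_, hS, rfl⟩)

/-! ### From winning finite games to a common model -/

namespace AbstractLogic

variable {L : AbstractLogic.{u, w} N}

/-- Isomorphism invariance of first-order logic is inherited from `L` through `firstOrder_sublogic`,
which avoids an induction on formulas. -/
theorem Regular.firstOrder_sat_iff [Infinite N] (hL : L.Regular) {A B : Struct N}
    {γ : (firstOrder N).Sentence} (hA : (firstOrder N).voc γ ⊆ A.voc)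
    (hB : (firstOrder N).voc γ ⊆ B.voc) {e : ∀ s, A.Dom s → B.Dom s} {σ : Set (Symbol N)}
    (hσ : (firstOrder N).voc γ ⊆ σ) (he : ∀ s, Symbol.sort s ∈ σ → Function.Bijective (e s))
    (hr : Struct.Respects σ A B e) : (firstOrder N).Sat A γ ↔ (firstOrder N).Sat B γ := by
  obtain ⟨θ, h1, h2⟩ := hL.firstOrder_sublogic γ
  rw [h1, h1]
  rw [h2] at hA hB hσ
  exact hL.sat_of_respects hA hB e (fun s hs => he s (hσ hs)) (hr.mono hσ)

/-- Models of two sentences that agree on suitable first-order sentences yield a chain of `m` sets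
of codes with the back-and-forth property. -/
theorem Regular.exists_finite_chain [Infinite N] (hL : L.Regular) {φ₁ φ₂ : L.Sentence} {g : N → N}
    (hg : Function.Injective g) {p : N} (o : N) (hp₁ : Symbol.sort p ∉ L.voc φ₁)
    (hp₂ : ∀ s, g s ≠ p) (hdisj : ∀ S, (Translation.ofNames g).onSymbol S ∉ L.voc φ₁)
    (hσ : IsVocabulary (L.voc φ₁ ∩ L.voc φ₂)) (hfin : (L.voc φ₁ ∩ L.voc φ₂).Finite)
    {ι : ℕ → N} (hι : Function.Injective ι) (m : ℕ) :
    ∃ Γ : Set (firstOrder N).Sentence, Γ.Finite ∧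
      (∀ γ ∈ Γ, (firstOrder N).voc γ ⊆ L.voc φ₁ ∩ L.voc φ₂) ∧
      ∀ M₁ M₂ : Struct N, L.Sat M₁ φ₁ → L.Sat M₂ φ₂ →
        (∀ γ ∈ Γ, (firstOrder N).Sat M₁ γ ↔ (firstOrder N).Sat M₂ γ) →
        ∃ D : Struct N, D.voc = Set.univ ∧ L.Sat D φ₁ ∧ L.Sat (D.along g) φ₂ ∧
          D.IsSystem (L.voc φ₁ ∩ L.voc φ₂) p o g ∧ (∃ z, D.subsetRel p (ι 0) z) ∧
          ∀ n < m, ∀ s, Symbol.sort s ∈ L.voc φ₁ ∩ L.voc φ₂ →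
            D.Forth p o g s (ι n) (ι (n + 1)) ∧ D.Back p o g s (ι n) (ι (n + 1)) := by
  obtain ⟨Γ, hΓ, hΓ₁, hΓ₂⟩ := exists_backForth_formulas hσ hfin m Set.finite_empty
  refine ⟨Subtype.val ⁻¹' Γ, hΓ.preimage Subtype.val_injective.injOn, fun γ hγ => (hΓ₁ _ hγ).1,
    fun M₁ M₂ h₁ h₂ hag => ?_⟩
  have hinv := Function.leftInverse_invFun hg
  -- `A` is the disjoint copy of `M₂`: read along `g` it is `M₂` again.
  set A := M₂.along (Function.invFun g) with hA
  have hAg : A.along g = M₂.full := M₂.along_along_of_leftInverse hinv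
  have hσ₂ := (L.isVocabulary φ₂).image_ofNames g
  have hM₁ := L.voc_subset h₁
  have hM₂ := L.voc_subset h₂
  -- The vocabulary of `φ₁` and the renamed one of `φ₂` are disjoint, so arbitrary maps satisfy the
  -- conditions for an amalgam.
  obtain ⟨C, f, h, hC, hf, hh, hfr, hhr⟩ := Struct.exists_amalgam (L.isVocabulary φ₁) hσ₂ M₁ A
    (fun s _ => (A.nonempty s).some) (by
      rintro s hs ⟨S, -, hS⟩
      exact (hdisj S (hS ▸ hs)).elim) (by
      constructor
      · rintro R n dom ⟨h, S, -, hS⟩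
        exact (hdisj S (hS ▸ h)).elim
      · rintro R n dom cod ⟨h, S, -, hS⟩
        exact (hdisj S (hS ▸ h)).elim)
  have hhr' : Struct.Respects (L.voc φ₂) (A.along g) (C.along g) fun s => h (g s) := hhr.along
  have hh' : ∀ s, Symbol.sort s ∈ L.voc φ₂ → Function.Bijective (h (g s)) :=
    fun s hs => hh _ ⟨_, hs, rfl⟩
  have hC₁ : L.Sat C φ₁ := (hL.sat_iff_of_bijective hM₁ hC subset_rfl hf hfr).1 h₁
  have hC₂ : L.Sat (C.along g) φ₂ := by
    refine (hL.sat_iff_of_bijective (A := A.along g) (Set.subset_univ _) rfl subset_rfl hh'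
      hhr').1 ?_
    rw [hAg]
    exact (hL.sat_full hM₂).2 h₂
  have v : ∀ s, ℕ → C.Dom s := fun s _ => (C.nonempty s).some
  have hbf : BackForth (L.voc φ₁ ∩ L.voc φ₂) C (C.along g) m ∅ := by
    have := hΓ₂ C (C.along g) v (fun s => v (g s)) ?_
    · simpa [valuePairs] using this
    · intro φ hφ
      have hφ0 : φ.freeVars = ∅ := Set.subset_empty_iff.1 (hΓ₁ φ hφ).2
      have hφv := (hΓ₁ φ hφ).1
      have e0 : ∀ (M : Struct N) (v : ∀ s, ℕ → M.Dom s), M.voc = Set.univ →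
          ((firstOrder N).Sat M ⟨φ, hφ0⟩ ↔ φ.Realize M v) := by
        intro M v hM
        refine ⟨fun h => h.2 v, fun h => ⟨hM ▸ Set.subset_univ _, fun w => ?_⟩⟩
        exact (φ.realize_congr M fun r k hr => by simp [hφ0] at hr).1 h
      refine (e0 C v hC).symm.trans (Iff.trans ?_ (e0 (C.along g) (fun s => v (g s)) rfl))
      have e1 := hL.firstOrder_sat_iff (γ := ⟨φ, hφ0⟩) ((hφv.trans Set.inter_subset_left).trans hM₁)
        (hC ▸ Set.subset_univ _) (hφv.trans Set.inter_subset_left) hf hfr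
      have e2 := hL.firstOrder_sat_iff (A := A.along g) (γ := ⟨φ, hφ0⟩) (Set.subset_univ _)
        (Set.subset_univ _) (hφv.trans Set.inter_subset_right) hh' hhr'
      rw [hAg] at e2
      have e3 := hL.firstOrder_sat_iff (A := M₂) (B := M₂.full) (γ := ⟨φ, hφ0⟩)
        ((hφv.trans Set.inter_subset_right).trans hM₂) (Set.subset_univ _)
        (e := fun _ => id) (Set.subset_univ _) (fun _ _ => Function.bijective_id)
        (M₂.respects_of_interp_eq fun _ _ => rfl)
      exact e1.symm.trans ((hag _ hφ).trans (e3.trans e2))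
  let P := {q : Set (Σ t, C.Dom t × C.Dom (g t)) //
    IsPartialIso (L.voc φ₁ ∩ L.voc φ₂) C (C.along g) q}
  have : Nonempty P := ⟨⟨∅, hbf.isPartialIso⟩⟩
  obtain ⟨D, hD, d1, d2, d3, d4, d5⟩ := hL.exists_system o hp₁ hp₂ hσ hC hC₁ hC₂ (P := P)
    -- Level `n` consists of the positions from which the second player still wins `m - n` rounds.
    (fun i q => ∃ n ≤ m, ι n = i ∧ BackForth (L.voc φ₁ ∩ L.voc φ₂) C (C.along g) (m - n) q.1)
    (fun q q' => q.1 ⊆ q'.1) Subtype.val (fun q => q.2) fun _ _ h => h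
  refine ⟨D, hD, d1, d2, d3, d4 _ ⟨⟨∅, hbf.isPartialIso⟩, 0, m.zero_le, rfl, hbf⟩, ?_⟩
  intro n hn s hs
  have hstep : ∀ q : P, (∃ k ≤ m, ι k = ι n ∧
      BackForth (L.voc φ₁ ∩ L.voc φ₂) C (C.along g) (m - k) q.1) →
      BackForth (L.voc φ₁ ∩ L.voc φ₂) C (C.along g) (m - (n + 1) + 1) q.1 := by
    rintro q ⟨k, -, hk, hq⟩
    rw [hι hk] at hq
    rwa [show m - (n + 1) + 1 = m - n by omega]
  refine ⟨(d5 s hs _ _).1 fun q a hq => ?_, (d5 s hs _ _).2 fun q b hq => ?_⟩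
  · obtain ⟨b, hb⟩ := (hstep q hq).2.1 s hs a
    exact ⟨⟨_, hb.isPartialIso⟩, ⟨n + 1, hn, rfl, hb⟩, Set.subset_insert _ _, b,
      Set.mem_insert _ _⟩
  · obtain ⟨a, ha⟩ := (hstep q hq).2.2 s hs b
    exact ⟨⟨_, ha.isPartialIso⟩, ⟨n + 1, hn, rfl, ha⟩, Set.subset_insert _ _, a,
      Set.mem_insert _ _⟩

/-- A finite subset of the union lies in a single `T m`, and countability of the union provides the
smallness that `Compact` demands. -/
theorem Compact.consistent_iUnion (hL : L.Compact) {T : ℕ → Set L.Sentence} (hT : Monotone T)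
    (hfin : ∀ n, (T n).Finite) (hc : ∀ n, L.Consistent (T n)) : L.Consistent (⋃ n, T n) := by
  have hcount : (⋃ n, T n).Countable := Set.countable_iUnion fun n => (hfin n).countable
  have := hcount.to_subtype
  refine hL _ (Countable.toSmall _) fun Γ hΓ hΓf => ?_
  have hex : ∀ φ : L.Sentence, ∃ n, φ ∈ Γ → φ ∈ T n := by
    intro φ
    by_cases h : φ ∈ Γ
    · obtain ⟨n, hn⟩ := Set.mem_iUnion.1 (hΓ h)
      exact ⟨n, fun _ => hn⟩
    · exact ⟨0, fun h' => (h h').elim⟩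
  choose k hk using hex
  obtain ⟨m, hm⟩ := (hΓf.image k).bddAbove
  obtain ⟨M, hM⟩ := hc m
  exact ⟨M, fun φ hφ => hM φ (hT (hm ⟨φ, hφ, rfl⟩) (hk φ hφ))⟩

/-- By compactness, arbitrarily long finite chains of sets of codes yield a set of codes that has
the back-and-forth property with respect to itself. -/
theorem Regular.exists_backForth_system [Infinite N] (hL : L.Regular) (hcomp : L.Compact)
    {φ₁ φ₂ : L.Sentence} {g : N → N} (hg : Function.Injective g) {p : N} (o : N)
    (hp₁ : Symbol.sort p ∉ L.voc φ₁) (hp₂ : ∀ s, g s ≠ p)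
    (hσ : IsVocabulary (L.voc φ₁ ∩ L.voc φ₂)) (hfin : (L.voc φ₁ ∩ L.voc φ₂).Finite) {ι : ℕ → N}
    (h : ∀ m, ∃ D : Struct N, D.voc = Set.univ ∧ L.Sat D φ₁ ∧ L.Sat (D.along g) φ₂ ∧
      D.IsSystem (L.voc φ₁ ∩ L.voc φ₂) p o g ∧ (∃ z, D.subsetRel p (ι 0) z) ∧
      ∀ n < m, ∀ s, Symbol.sort s ∈ L.voc φ₁ ∩ L.voc φ₂ →
        D.Forth p o g s (ι n) (ι (n + 1)) ∧ D.Back p o g s (ι n) (ι (n + 1))) :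
    ∃ D : Struct N, D.voc = Set.univ ∧ L.Sat D φ₁ ∧ L.Sat (D.along g) φ₂ ∧
      D.IsSystem (L.voc φ₁ ∩ L.voc φ₂) p o g ∧ (∃ z, D.subsetRel p o z) ∧
      ∀ s, Symbol.sort s ∈ L.voc φ₁ ∩ L.voc φ₂ → D.Forth p o g s o o ∧ D.Back p o g s o o := by
  set σ := L.voc φ₁ ∩ L.voc φ₂
  obtain ⟨φ₂', -, hφ₂'⟩ := hL.exists_rename hg φ₂
  choose P hP using fun S => hL.expressible_preserves p o g S
  choose E hE using fun s => hL.expressible_extends p o g s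
  choose F hF using fun s n => hL.expressible_forth p o g s (ι n) (ι (n + 1))
  choose B hB using fun s n => hL.expressible_back p o g s (ι n) (ι (n + 1))
  obtain ⟨I, hI⟩ := hL.expressible_nonempty p (ι 0)
  have hsort : {s | Symbol.sort s ∈ σ}.Finite :=
    hfin.preimage (Function.Injective.injOn fun _ _ => Symbol.sort.inj)
  -- Only the forth and back clauses depend on `m`: those from level `n` to level `n + 1` for `n <
  -- m`, which a chain of length `m` satisfies.
  let T : ℕ → Set L.Sentence := fun m => {φ₁, φ₂', I} ∪ P '' σ ∪ E '' {s | Symbol.sort s ∈ σ} ∪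
    ⋃ n ∈ Set.Iio m, ((F · n) '' {s | Symbol.sort s ∈ σ} ∪ (B · n) '' {s | Symbol.sort s ∈ σ})
  obtain ⟨M, hM⟩ := hcomp.consistent_iUnion (T := T)
    (fun m m' hm => Set.union_subset_union_right _ (Set.biUnion_subset_biUnion_left
      (Set.Iio_subset_Iio hm)))
    (fun m => (((Set.toFinite _).union (hfin.image _)).union (hsort.image _)).union
      ((Set.finite_Iio m).biUnion fun n _ => (hsort.image _).union (hsort.image _)))
    (by
      intro m
      obtain ⟨D, hD, h1, h2, h3, h4, h5⟩ := h m
      refine ⟨D, ?_⟩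
      rintro φ ((((rfl | rfl | rfl) | ⟨S, hS, rfl⟩) | ⟨s, hs, rfl⟩) | hφ)
      · exact h1
      · exact (hφ₂' D (hD ▸ Set.subset_univ _)).2 h2
      · exact (hI D hD).2 h4
      · exact (hP S D hD).2 (h3.preserves S hS)
      · exact (hE s D hD).2 (h3.extend s hs)
      · simp only [Set.mem_iUnion] at hφ
        obtain ⟨n, hn, ⟨s, hs, rfl⟩ | ⟨s, hs, rfl⟩⟩ := hφ
        · exact (hF s n D hD).2 (h5 n hn s hs).1
        · exact (hB s n D hD).2 (h5 n hn s hs).2)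
  have hM' : ∀ m, ∀ φ ∈ T m, L.Sat M.full φ := fun m φ hφ => by
    have := hM φ (Set.mem_iUnion.2 ⟨m, hφ⟩)
    exact (hL.sat_full (L.voc_subset this)).2 this
  set C := M.full with hC
  have hCv : C.voc = Set.univ := rfl
  have c1 : L.Sat C φ₁ := hM' 0 _ (Or.inl (Or.inl (Or.inl (Or.inl rfl))))
  have c2 : L.Sat (C.along g) φ₂ := (hφ₂' C (hCv ▸ Set.subset_univ _)).1
    (hM' 0 _ (Or.inl (Or.inl (Or.inl (Or.inr (Or.inl rfl))))))
  obtain ⟨z₀, hz₀⟩ := (hI C hCv).1 (hM' 0 _ (Or.inl (Or.inl (Or.inl (Or.inr (Or.inr rfl))))))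
  have c3 : ∀ S ∈ σ, C.Preserves p o g S := fun S hS =>
    (hP S C hCv).1 (hM' 0 _ (Or.inl (Or.inl (Or.inr ⟨S, hS, rfl⟩))))
  have c4 : ∀ s, Symbol.sort s ∈ σ → C.Extends p o g s := fun s hs =>
    (hE s C hCv).1 (hM' 0 _ (Or.inl (Or.inr ⟨s, hs, rfl⟩)))
  have c5 : ∀ n s, Symbol.sort s ∈ σ → C.Forth p o g s (ι n) (ι (n + 1)) := fun n s hs =>
    (hF s n C hCv).1 (hM' (n + 1) _ (Or.inr (Set.mem_biUnion (Nat.lt_succ_self n)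
      (Or.inl ⟨s, hs, rfl⟩))))
  have c6 : ∀ n s, Symbol.sort s ∈ σ → C.Back p o g s (ι n) (ι (n + 1)) := fun n s hs =>
    (hB s n C hCv).1 (hM' (n + 1) _ (Or.inr (Set.mem_biUnion (Nat.lt_succ_self n)
      (Or.inr ⟨s, hs, rfl⟩))))
  -- The levels are merged. A move leads from level `n` to level `n + 1`, hence stays in the union,
  -- so one set of codes, named `o`, suffices.
  let Q := {z : C.Dom p // ∃ n, C.subsetRel p (ι n) z}
  have : Nonempty Q := ⟨⟨z₀, 0, hz₀⟩⟩
  obtain ⟨D, hD, d1, d2, d3, d4, d5⟩ := hL.exists_system o hp₁ hp₂ hσ hCv c1 c2 (P := Q)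
    (fun i _ => i = o) (fun z z' => C.extRel p o z.1 z'.1)
    -- Pairs in other sorts are discarded because `c4` gives extension of the coded maps only in the
    -- sorts of `σ`.
    (fun z => {x | Symbol.sort x.1 ∈ σ ∧ C.graphRel p o x.1 (g x.1) z.1 x.2.1 x.2.2})
    (fun z S hS x y hxy => c3 S hS z.1 x y fun i => (hxy i).2)
    (fun z z' hz x hx => ⟨hx.1, c4 x.1 hx.1 _ _ _ _ hz hx.2⟩)
  refine ⟨D, hD, d1, d2, d3, d4 o ⟨⟨z₀, 0, hz₀⟩, rfl⟩, fun s hs => ⟨(d5 s hs o o).1 ?_,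
    (d5 s hs o o).2 ?_⟩⟩
  · rintro ⟨z, n, hz⟩ a -
    obtain ⟨z', h1, h2, b, hb⟩ := c5 n s hs z a hz
    exact ⟨⟨z', n + 1, h1⟩, rfl, h2, b, hs, hb⟩
  · rintro ⟨z, n, hz⟩ b -
    obtain ⟨z', h1, h2, a, ha⟩ := c6 n s hs z b hz
    exact ⟨⟨z', n + 1, h1⟩, rfl, h2, a, hs, ha⟩

/-- By the Löwenheim property, a system of codes with the back-and-forth property yields a common
model of two sentences. -/
theorem Regular.exists_common_model [Infinite N] (hL : L.Regular) (hlow : L.Lowenheim)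
    {φ₁ φ₂ : L.Sentence} {g : N → N} (hg : Function.Injective g) {p o : N}
    (hσ : IsVocabulary (L.voc φ₁ ∩ L.voc φ₂)) (hfin : (L.voc φ₁ ∩ L.voc φ₂).Finite)
    (h : ∃ D : Struct N, D.voc = Set.univ ∧ L.Sat D φ₁ ∧ L.Sat (D.along g) φ₂ ∧
      D.IsSystem (L.voc φ₁ ∩ L.voc φ₂) p o g ∧ (∃ z, D.subsetRel p o z) ∧
      ∀ s, Symbol.sort s ∈ L.voc φ₁ ∩ L.voc φ₂ → D.Forth p o g s o o ∧ D.Back p o g s o o) :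
    ∃ M : Struct N, L.Sat M φ₁ ∧ L.Sat M φ₂ := by
  set σ := L.voc φ₁ ∩ L.voc φ₂ with hσdef
  obtain ⟨φ₂', -, hφ₂'⟩ := hL.exists_rename hg φ₂
  choose P hP using fun S => hL.expressible_preserves p o g S
  choose E hE using fun s => hL.expressible_extends p o g s
  choose F hF using fun s => hL.expressible_forth p o g s o o
  choose B hB using fun s => hL.expressible_back p o g s o o
  -- These trivial equations force the sorts `g s` into the vocabulary of the countable model;
  -- countability says nothing about domains of other sorts.
  choose V hV using fun s => hL.exists_closure (.eq (.var (g s) 0) (.var (g s) 0))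
  obtain ⟨I, hI⟩ := hL.expressible_nonempty p o
  have hsort : {s | Symbol.sort s ∈ σ}.Finite :=
    hfin.preimage (Function.Injective.injOn fun _ _ => Symbol.sort.inj)
  obtain ⟨ψ, -, hψ⟩ := hL.exists_conj φ₁ (Γ := {φ₂', I} ∪ P '' σ ∪ E '' {s | Symbol.sort s ∈ σ} ∪
      F '' {s | Symbol.sort s ∈ σ} ∪ B '' {s | Symbol.sort s ∈ σ} ∪ V '' {s | Symbol.sort s ∈ σ})
    ((((((Set.toFinite _).union (hfin.image _)).union (hsort.image _)).union
      (hsort.image _)).union (hsort.image _)).union (hsort.image _))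
  obtain ⟨M, hMψ, hMc⟩ := hlow ψ (by
    obtain ⟨D, hD, h1, h2, h3, h4, h5⟩ := h
    refine ⟨D, (hψ D).2 ⟨h1, ?_⟩⟩
    rintro φ ((((((rfl | rfl) | ⟨S, hS, rfl⟩) | ⟨s, hs, rfl⟩) | ⟨s, hs, rfl⟩) | ⟨s, hs, rfl⟩) |
      ⟨s, hs, rfl⟩)
    · exact (hφ₂' D (hD ▸ Set.subset_univ _)).2 h2
    · exact (hI D hD).2 h4
    · exact (hP S D hD).2 (h3.preserves S hS)
    · exact (hE s D hD).2 (h3.extend s hs)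
    · exact (hF s D hD).2 (h5 s hs).1
    · exact (hB s D hD).2 (h5 s hs).2
    · exact (hV s D).2 ⟨hD ▸ Set.subset_univ _, fun v => rfl⟩)
  obtain ⟨m1, hM⟩ := (hψ M).1 hMψ
  have hfull : ∀ φ, L.Sat M φ → L.Sat M.full φ := fun φ h => (hL.sat_full (L.voc_subset h)).2 h
  have hs₁ : ∀ s, Symbol.sort s ∈ σ → Symbol.sort s ∈ M.voc := fun s hs =>
    L.voc_subset m1 hs.1
  have hs₂ : ∀ s, Symbol.sort s ∈ σ → Symbol.sort (g s) ∈ M.voc := fun s hs =>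
    ((hV s M).1 (hM _ (Or.inr ⟨s, hs, rfl⟩))).1 (Or.inl rfl)
  have hD : M.full.voc = Set.univ := rfl
  have hc : Countable (Σ s : {s // Symbol.sort s ∈ σ}, M.Dom s.1 ⊕ M.Dom (g s.1)) := by
    have : ∀ s, Symbol.sort s ∈ M.voc → Countable (M.Dom s) := fun s hs => by
      have : Countable (Σ s : {s : N // Symbol.sort s ∈ M.voc}, M.Dom s.1) := hMc
      refine Function.Injective.countable
        (f := fun a => (⟨⟨s, hs⟩, a⟩ : Σ s : {s : N // Symbol.sort s ∈ M.voc}, M.Dom s.1))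
        fun a b h => ?_
      cases h
      rfl
    have : ∀ s : {s // Symbol.sort s ∈ σ}, Countable (M.Dom s.1 ⊕ M.Dom (g s.1)) := fun s => by
      have := this s.1 (hs₁ s.1 s.2)
      have := ‹∀ s, Symbol.sort s ∈ M.voc → Countable (M.Dom s)› _ (hs₂ s.1 s.2)
      infer_instance
    have : Countable {s // Symbol.sort s ∈ σ} := hsort.countable.to_subtype
    infer_instance
  have hsys : M.full.IsSystem σ p o g :=
    ⟨fun S hS => (hP S M.full hD).1 (hfull _ (hM _
      (Or.inl (Or.inl (Or.inl (Or.inl (Or.inr ⟨S, hS, rfl⟩))))))),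
    fun s hs => (hE s M.full hD).1 (hfull _ (hM _ (Or.inl (Or.inl (Or.inl (Or.inr
      ⟨s, hs, rfl⟩))))))⟩
  obtain ⟨e, he, her⟩ := hsys.exists_iso hσ (i := o)
    (fun s hs => (hF s M.full hD).1 (hfull _ (hM _ (Or.inl (Or.inl (Or.inr ⟨s, hs, rfl⟩))))))
    (fun s hs => (hB s M.full hD).1 (hfull _ (hM _ (Or.inl (Or.inr ⟨s, hs, rfl⟩)))))
    ((hI M.full hD).1 (hfull _ (hM _ (Or.inl (Or.inl (Or.inl (Or.inl (Or.inl (Or.inr rfl)))))))))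
    hc
  -- The model of `φ₁` and the model of `φ₂` are now isomorphic in the common vocabulary and can be
  -- glued along `e`.
  obtain ⟨C, f, k, hC, hf, hk, hfr, hkr⟩ := Struct.exists_amalgam (L.isVocabulary φ₁)
    (L.isVocabulary φ₂) M.full (M.full.along g) e (fun s h1 h2 => he s ⟨h1, h2⟩) her
  refine ⟨C, (hL.sat_iff_of_bijective (Set.subset_univ _) hC subset_rfl hf hfr).1 (hfull _ m1),
    (hL.sat_iff_of_bijective (Set.subset_univ _) hC subset_rfl hk hkr).1 ?_⟩
  exact (hφ₂' M.full (Set.subset_univ _)).1 (hfull _ (hM _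
    (Or.inl (Or.inl (Or.inl (Or.inl (Or.inl (Or.inl rfl))))))))

/-! ### Separation, Lindström's theorem and the Robinson property -/

/-- Sentences without a common model that share a symbol are separated by a first-order sentence in
their common vocabulary. -/
theorem Regular.exists_separator [Infinite N] (hL : L.Regular) (hcomp : L.Compact)
    (hlow : L.Lowenheim) (hfin : L.FiniteOccurrence) {φ₁ φ₂ : L.Sentence} {S : Symbol N}
    (hS₁ : S ∈ L.voc φ₁) (hS₂ : S ∈ L.voc φ₂)
    (hno : ∀ M, L.Sat M φ₁ → ¬ L.Sat M φ₂) :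
    ∃ θ : (firstOrder N).Sentence, (firstOrder N).voc θ ⊆ L.voc φ₁ ∩ L.voc φ₂ ∧
      (∀ M, L.Sat M φ₁ → (firstOrder N).Sat M θ) ∧
      ∀ M, L.Sat M φ₂ → ¬ (firstOrder N).Sat M θ := by
  by_contra hsep
  have hσ := (L.isVocabulary φ₁).inter (L.isVocabulary φ₂) hS₁ hS₂
  have hσf := (hfin φ₁).inter_of_left (L.voc φ₂)
  obtain ⟨p, g, hg, hp₁, hp₂, hdisj⟩ := exists_fresh_names (hfin φ₁)
  let ι := Infinite.natEmbedding N
  obtain ⟨M, h1, h2⟩ := hL.exists_common_model hlow hg (p := p) (o := p) hσ hσf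
    -- The name `p` also serves as `o`, since a relation symbol is never a sort symbol.
    (hL.exists_backForth_system hcomp hg p hp₁ hp₂ hσ hσf (ι := ι) fun m => by
      obtain ⟨Γ, hΓ, hΓ₁, hΓ₂⟩ :=
        hL.exists_finite_chain hg p hp₁ hp₂ hdisj hσ hσf ι.injective m
      by_contra hno'
      -- If there were no chain of length `m`, any models of `φ₁` and `φ₂` would disagree on `Γ`,
      -- and a Boolean combination of `Γ` would separate.
      refine hsep (exists_separator_of_finite hσ hσf hΓ hΓ₁ (K₁ := (L.Sat · φ₁))
        (K₂ := (L.Sat · φ₂)) (fun M hM => Set.inter_subset_left.trans (L.voc_subset hM))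
        (fun M hM => Set.inter_subset_right.trans (L.voc_subset hM)) fun A B hA hB => ?_)
      by_contra! hag
      exact hno' (hΓ₂ A B hA hB hag))
  exact hno M h1 h2

/-- Lindström's theorem: every sentence is equivalent to a first-order sentence. -/
theorem Regular.sublogic_firstOrder [Infinite N] (hL : L.Regular) (hcomp : L.Compact)
    (hlow : L.Lowenheim) (hfin : L.FiniteOccurrence) : L.Sublogic (firstOrder N) := by
  intro φ
  obtain ⟨ψ, h1, h2⟩ := hL.negation_property φ
  obtain ⟨S, hS⟩ := (L.isVocabulary φ).nonempty
  obtain ⟨θ, t1, t2, t3⟩ := hL.exists_separator hcomp hlow hfin hS (h1 ▸ hS)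
    fun M hM hM' => (h2 M (L.voc_subset hM)).1 hM' hM
  obtain ⟨η, e1, e2⟩ := exists_valid (L.isVocabulary φ) (hfin φ)
  -- The separator may use fewer symbols than `φ`; the valid sentence `η` restores the vocabulary.
  obtain ⟨κ, k1, k2⟩ := firstOrder_and η θ
  have hκ : (firstOrder N).voc κ = L.voc φ := by
    rw [k1, e1]
    exact Set.union_eq_self_of_subset_right (t1.trans Set.inter_subset_left)
  refine ⟨κ, fun M => ⟨fun hM => (k2 M).2 ⟨e2 M (L.voc_subset hM), t2 M hM⟩, fun hM => ?_⟩, hκ.symm⟩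
  by_contra hn
  have hv : L.voc φ ⊆ M.voc := hκ ▸ (firstOrder N).voc_subset hM
  exact t3 M ((h2 M hv).2 hn) ((k2 M).1 hM).2

/-- Compactness for classes of sentences in a logic whose sentences are equivalent to first-order
sentences. -/
theorem Compact.consistent_of_sublogic (hcomp : L.Compact) (hsub : L.Sublogic (firstOrder N))
    (T : Set L.Sentence)
    (h : ∀ Γ : Set L.Sentence, Γ ⊆ T → Γ.Finite → L.Consistent Γ) : L.Consistent T := by
  choose tr htr using hsub
  -- First-order sentences form a type in the universe of the domains. One member of `T` for each
  -- translation thus gives a small set with the same models as `T`.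
  have hsec : ∀ x : tr '' T, ∃ φ ∈ T, tr φ = x.1 := fun x => x.2
  choose sec hsec₁ hsec₂ using hsec
  have hsmall : Small.{u} (Set.range sec) := inferInstance
  obtain ⟨M, hM⟩ := hcomp (Set.range sec) hsmall fun Γ hΓ hf =>
    h Γ (hΓ.trans (Set.range_subset_iff.2 hsec₁)) hf
  refine ⟨M, fun φ hφ => ?_⟩
  have := hM _ ⟨⟨tr φ, φ, hφ, rfl⟩, rfl⟩
  rwa [(htr _).1, hsec₂, ← (htr φ).1] at this

/-- The Robinson property. -/
theorem Regular.robinson [Infinite N] (hL : L.Regular) (hcomp : L.Compact)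
    (hlow : L.Lowenheim) (hfin : L.FiniteOccurrence) : L.Robinson := by
  rintro T₀ T₁ T₂ ⟨M₀, rfl⟩ ⟨M₁, hM₁⟩ h₁ ⟨M₂, hM₂⟩ h₂ hvoc
  refine hcomp.consistent_of_sublogic (hL.sublogic_firstOrder hcomp hlow hfin) _
    fun Γ hΓ hΓf => ?_
  obtain ⟨S, hS⟩ := M₀.isVocabulary.nonempty
  -- The finite parts of `T₁` and `T₂` may share no symbol, as separation requires. The valid
  -- sentence `τ`, which belongs to the complete theory, is added to both.
  obtain ⟨τ, hτ⟩ := hL.exists_closure (.imp (S.atom (.id N) fun _ => 0)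
    (S.atom (.id N) fun _ => 0))
  have hτ₀ : L.Sat M₀ τ := (hτ M₀).2 ⟨Set.union_subset
    (Symbol.voc_atom_id_subset M₀.isVocabulary hS _)
    (Symbol.voc_atom_id_subset M₀.isVocabulary hS _),
    fun v => (Formula.realize_imp _ _ _ _).2 fun h => h⟩
  obtain ⟨R, hR⟩ := (L.isVocabulary τ).nonempty
  obtain ⟨ψ₁, a1, a2⟩ := hL.exists_conj τ (hΓf.inter_of_left T₁)
  obtain ⟨ψ₂, b1, b2⟩ := hL.exists_conj τ (hΓf.inter_of_left T₂)
  have hψ₁ : L.Sat M₁ ψ₁ := (a2 M₁).2 ⟨hM₁ τ (h₁ hτ₀), fun φ hφ => hM₁ φ hφ.2⟩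
  have hψ₂ : L.Sat M₂ ψ₂ := (b2 M₂).2 ⟨hM₂ τ (h₂ hτ₀), fun φ hφ => hM₂ φ hφ.2⟩
  by_contra hno
  obtain ⟨θ, t1, t2, t3⟩ := hL.exists_separator hcomp hlow hfin (φ₁ := ψ₁) (φ₂ := ψ₂) (S := R)
    (a1 ▸ Or.inl hR) (b1 ▸ Or.inl hR) fun M hM hM' => hno ⟨M, fun φ hφ =>
      (hΓ hφ).elim (fun h => ((a2 M).1 hM).2 φ ⟨hφ, h⟩) fun h => ((b2 M).1 hM').2 φ ⟨hφ, h⟩⟩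
  obtain ⟨η, e1, e2⟩ := hL.firstOrder_sublogic θ
  have hv₁ : L.voc ψ₁ ⊆ L.theoryVoc T₁ := by
    rw [a1]
    exact Set.union_subset (Set.subset_biUnion_of_mem (u := L.voc) (h₁ hτ₀))
      (Set.biUnion_subset_biUnion_left Set.inter_subset_right)
  have hv₂ : L.voc ψ₂ ⊆ L.theoryVoc T₂ := by
    rw [b1]
    exact Set.union_subset (Set.subset_biUnion_of_mem (u := L.voc) (h₂ hτ₀))
      (Set.biUnion_subset_biUnion_left Set.inter_subset_right)
  have hη : L.voc η ⊆ M₀.voc := by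
    rw [← e2]
    refine (t1.trans (Set.inter_subset_inter hv₁ hv₂)).trans (hvoc.subset.trans ?_)
    exact Set.iUnion₂_subset fun φ hφ => L.voc_subset hφ
  -- The separator is decided by the complete theory: if true in `M₀` it holds in `M₂`, and if false
  -- its negation holds in `M₁`; both are impossible.
  by_cases hM : L.Sat M₀ η
  · exact t3 M₂ hψ₂ ((e1 M₂).2 (hM₂ η (h₂ hM)))
  · obtain ⟨ν, n1, n2⟩ := hL.negation_property η
    have hν := hM₁ ν (h₁ ((n2 M₀ hη).2 hM))
    exact (n2 M₁ (n1 ▸ L.voc_subset hν)).1 hν ((e1 M₁).1 (t2 M₁ hψ₁))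

end AbstractLogic

end ManySorted

theorem mainTheorem4 {N : Type u} [Infinite N] (L : ManySorted.AbstractLogic.{u, w} N)
    (hreg : L.Regular) (hcomp : L.Compact) (hlow : L.Lowenheim) (hfin : L.FiniteOccurrence) :
    L.Robinson ∧ L.Equivalent (ManySorted.firstOrder N) :=
  ⟨hreg.robinson hcomp hlow hfin, hreg.sublogic_firstOrder hcomp hlow hfin,
    hreg.firstOrder_sublogic⟩
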